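/- Consider a two-user state-dependent memoryless multiple access channel $W_{Y|X_1,X_2,S}$ with finite input alphabets $\mathcal X_1,\mathcal X_2$, finite state alphabet $\mathcal S$, output alphabet $\mathcal Y$ (any measurable space, in particular any finite one), and states $S_1,S_2,\dots$ i.i.d. with law $Q_S$. A common message $W_c$ and an individual message $W_1$ are independent and uniform on sets of $M_c\ge 1$ and $M_1\ge 1$ elements. Encoder 1 sends both messages, Encoder 2 sends only $W_c$. Suppose that the states are known strictly causally at Encoder 1 only: in a code of block length $n\ge 1$, for $i=1,\dots,n$, the input of Encoder 1 at time $i$ is $X_{1,i}=\phi_{1,i}(W_c,W_1,S^{i-1})$, the input of Encoder 2 is $X_{2,i}=\phi_{2,i}(W_c)$, and the decoder estimates $(W_c,W_1)$ by $\psi(Y^n)$. Such a code is an $(M_c,M_1,n,\epsilon)$ code if its average probability of error, over the messages, the states and the channel, is at most $\epsilon$. A pair $(R_c,R_1)$ is achievable if for every $\epsilon>0$ there is a $(2^{nR_c},2^{nR_1},n,\epsilon)$ code for some $n\ge1$, and the capacity region is the closure of the set of achievable pairs. Then the knowledge of the states does not increase the capacity region: the capacity region is equal to the capacity region of the same channel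 when the states are known neither to the encoders nor to the decoder (that is, with codes in which $X_{1,i}=\phi_{1,i}(W_c,W_1)$). Moreover, it is equal to the set of all pairs $(R_c,R_1)$ with $R_c,R_1\ge 0$ such that $$R_1\le I(X_1;Y|X_2),\qquad R_c+R_1\le I(X_1,X_2;Y)$$ for some joint law of the form $$P_{S,X_1,X_2,Y}=Q_S\,P_{X_2}\,P_{X_1|X_2}\,W_{Y|X_1,X_2,S},$$ where the mutual informations are in bits. -/

import Mathlib

open MeasureTheory ProbabilityTheory InformationTheory
open scoped ENNReal

noncomputable section

namespace CoopMAC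

/-! Information measures, in bits. -/

/-- Mutual information `I(A;B)`, in bits, of two random variables under `μ`: the Kullback-Leibler
divergence of the joint law from the product of the marginal laws. -/
def mutualInfo {Ω α β : Type*} [MeasurableSpace Ω] [MeasurableSpace α] [MeasurableSpace β]
    (μ : Measure Ω) (A : Ω → α) (B : Ω → β) : ℝ≥0∞ :=
  klDiv (μ.map fun ω => (A ω, B ω)) ((μ.map A).prod (μ.map B)) / ENNReal.ofReal (Real.log 2)

/-- Conditional mutual information `I(A;B|C) = ∑ c, P(C = c) I(A;B|C = c)`, in bits, for a random
variable `C` with values in a finite set. -/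
def condMutualInfo {Ω α β γ : Type*} [MeasurableSpace Ω] [MeasurableSpace α] [MeasurableSpace β]
    [Fintype γ] (μ : Measure Ω) (A : Ω → α) (B : Ω → β) (C : Ω → γ) : ℝ≥0∞ :=
  ∑ c : γ, μ (C ⁻¹' {c}) * mutualInfo (ProbabilityTheory.cond μ (C ⁻¹' {c})) A B

/-! Codes. Times are numbered from `0`, so at time `i : Fin n` the strictly past states are the
`i` states at the times `0, …, i - 1`, and messages are elements of `Fin Mc` and `Fin M₁`. -/

/-- A block code of length `n` when the states are known strictly causally at Encoder 1 (the one
that sends both messages), and at no other terminal. -/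
structure InformedCode (S X₁ X₂ Y : Type*) [MeasurableSpace Y] (Mc M₁ n : ℕ) where
  enc₁ : (i : Fin n) → Fin Mc → Fin M₁ → (Fin i.val → S) → X₁
  enc₂ : Fin n → Fin Mc → X₂
  dec : (Fin n → Y) → Fin Mc × Fin M₁
  measurable_dec : Measurable dec

/-- A block code of length `n` when the states are known at no terminal. -/
structure UninformedCode (X₁ X₂ Y : Type*) [MeasurableSpace Y] (Mc M₁ n : ℕ) where
  enc₁ : Fin n → Fin Mc → Fin M₁ → X₁
  enc₂ : Fin n → Fin Mc → X₂
  dec : (Fin n → Y) → Fin Mc × Fin M₁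
  measurable_dec : Measurable dec

section Channel

variable {S X₁ X₂ Y : Type*} [MeasurableSpace S] [MeasurableSpace X₁] [MeasurableSpace X₂]
  [MeasurableSpace Y]

/-- Average probability of error over independent uniform messages, states drawn i.i.d. from `Q`,
and outputs drawn from the memoryless channel `W`. Here `x₁ wc w₁ s` is the input sequence of
Encoder 1 for the messages `(wc, w₁)` and the state sequence `s`, and `x₂ wc` is the one of
Encoder 2. -/
def errorProb {Mc M₁ n : ℕ} (Q : Measure S) (W : Kernel ((X₁ × X₂) × S) Y)
    (x₁ : Fin Mc → Fin M₁ → (Fin n → S) → Fin n → X₁) (x₂ : Fin Mc → Fin n → X₂)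
    (dec : (Fin n → Y) → Fin Mc × Fin M₁) : ℝ≥0∞ :=
  (∑ wc : Fin Mc, ∑ w₁ : Fin M₁,
    ∫⁻ s, Measure.pi (fun i => W ((x₁ wc w₁ s i, x₂ wc i), s i)) {y | dec y ≠ (wc, w₁)}
      ∂(Measure.pi fun _ : Fin n => Q)) / ((Mc : ℝ≥0∞) * (M₁ : ℝ≥0∞))

/-- Error probability of a code with strictly causal states at Encoder 1 only. -/
def InformedCode.error {Mc M₁ n : ℕ} (c : InformedCode S X₁ X₂ Y Mc M₁ n)
    (Q : Measure S) (W : Kernel ((X₁ × X₂) × S) Y) : ℝ≥0∞ :=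
  errorProb Q W (fun wc w₁ s i => c.enc₁ i wc w₁ fun j => s (Fin.castLE i.isLt.le j))
    (fun wc i => c.enc₂ i wc) c.dec

/-- Error probability of a code without state information. -/
def UninformedCode.error {Mc M₁ n : ℕ} (c : UninformedCode X₁ X₂ Y Mc M₁ n)
    (Q : Measure S) (W : Kernel ((X₁ × X₂) × S) Y) : ℝ≥0∞ :=
  errorProb Q W (fun wc w₁ _ i => c.enc₁ i wc w₁) (fun wc i => c.enc₂ i wc) c.dec

/-- `(Rc, R₁)` is achievable with strictly causal states at Encoder 1 only: for every `ε > 0` there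
is a `(2 ^ (n Rc), 2 ^ (n R₁), n, ε)` code. -/
def InformedAchievable (Q : Measure S) (W : Kernel ((X₁ × X₂) × S) Y) (R : ℝ × ℝ) : Prop :=
  ∀ ε : ℝ, 0 < ε → ∃ n Mc M₁ : ℕ, 0 < n ∧ 0 < Mc ∧ 0 < M₁ ∧
    (Mc : ℝ) = (2 : ℝ) ^ ((n : ℝ) * R.1) ∧ (M₁ : ℝ) = (2 : ℝ) ^ ((n : ℝ) * R.2) ∧
    ∃ c : InformedCode S X₁ X₂ Y Mc M₁ n, c.error Q W ≤ ENNReal.ofReal ε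

/-- `(Rc, R₁)` is achievable without state information. -/
def UninformedAchievable (Q : Measure S) (W : Kernel ((X₁ × X₂) × S) Y) (R : ℝ × ℝ) : Prop :=
  ∀ ε : ℝ, 0 < ε → ∃ n Mc M₁ : ℕ, 0 < n ∧ 0 < Mc ∧ 0 < M₁ ∧
    (Mc : ℝ) = (2 : ℝ) ^ ((n : ℝ) * R.1) ∧ (M₁ : ℝ) = (2 : ℝ) ^ ((n : ℝ) * R.2) ∧
    ∃ c : UninformedCode X₁ X₂ Y Mc M₁ n, c.error Q W ≤ ENNReal.ofReal ε

/-- Capacity region with the states known strictly causally at Encoder 1 only. -/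
def informedCapacityRegion (Q : Measure S) (W : Kernel ((X₁ × X₂) × S) Y) : Set (ℝ × ℝ) :=
  closure {R | InformedAchievable Q W R}

/-- Capacity region with the states known nowhere. -/
def uninformedCapacityRegion (Q : Measure S) (W : Kernel ((X₁ × X₂) × S) Y) : Set (ℝ × ℝ) :=
  closure {R | UninformedAchievable Q W R}

/-- The pairs `(Rc, R₁)` of rates such that `R₁ ≤ I(X₁;Y|X₂)` and `Rc + R₁ ≤ I(X₁,X₂;Y)` for some
joint law of `(((X₁, X₂), S), Y)` in which `(X₁, X₂)` has any law `P`, the state `S` has law `Q` and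
is independent of `(X₁, X₂)`, and `Y` is the output of the channel `W`. -/
def singleLetterRegion [Fintype X₂] (Q : Measure S) (W : Kernel ((X₁ × X₂) × S) Y) :
    Set (ℝ × ℝ) :=
  {R | 0 ≤ R.1 ∧ 0 ≤ R.2 ∧ ∃ P : Measure (X₁ × X₂), IsProbabilityMeasure P ∧
    ENNReal.ofReal R.2 ≤ condMutualInfo ((P.prod Q).compProd W)
      (fun ω => ω.1.1.1) (fun ω => ω.2) (fun ω => ω.1.1.2) ∧
    ENNReal.ofReal (R.1 + R.2) ≤ mutualInfo ((P.prod Q).compProd W)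
      (fun ω => ω.1.1) (fun ω => ω.2)}

end Channel

end CoopMAC

end

namespace CoopMAC

/-! A code without states is an informed code that ignores them, so it suffices to place the
informed region inside the single-letter region and the latter inside the uninformed region. Let `v
x` be the density of the output for the input pair `x`, averaged over the state.

Converse. Let `p` be the law of the input pair at a uniformly chosen time, and `r γ` the output
density that `p` induces given the value `γ` of a map `c` of the inputs; `c = Prod.snd` serves the
bound on `R₁`, a constant `c` the bound on the sum rate. Compare the true law of `Y^n` for a message
with the product of the `r (γ i)`. The `γ i` depend on the message alone, because Encoder 2 sees no
state. The input at time `i` uses past states only, which enters twice. Summing over states from the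
last to the first, `∑ t, q t * w (x, t) = v x`, so the weights `∏ q * w * (r / v)` sum to at most `∏
r` (`sum_prod_causal_le`). And `s_i` is independent of the input at time `i`, so the mean of `log (v
/ r)` at time `i` is a single-letter term in `v` (`sum_prod_resample`). With `1 + t ≤ exp t` this
gives a change of measure inequality (`integral_sum_mul_le`), and a two-valued test function turns
it into a strong form of Fano's inequality (`converse_bound`). As `r` is built from the
time-averaged law, the information terms add up exactly to `n * condInfo`, without a concavity
argument. The error tends to `0` along a sequence of codes; compactness of the simplex and
continuity of `condInfo` give one limiting law that serves both bounds.

Achievability. Random superposition coding: Encoder 2's codewords are cloud centres, Encoder 1's are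
drawn conditionally on them. The decoder thresholds two likelihood ratios; Chebyshev's inequality
controls the true message and Markov's inequality the wrong ones (`exists_superposition_code`,
`exists_uninformedCode`). -/

/-- A family of probability densities with respect to `m`, bounded by `1`. -/
structure IsDensityFamily {X Y : Type*} [MeasurableSpace Y] (m : Measure Y) (v : X → Y → ℝ) :
    Prop where
  measurable : ∀ x, Measurable (v x)
  nonneg : ∀ x y, 0 ≤ v x y
  le_one : ∀ x y, v x y ≤ 1
  integral_eq_one : ∀ x, ∫ y, v x y ∂m = 1

/-! ### Elementary bounds -/

theorem abs_mul_log_le_one {t : ℝ} (h0 : 0 ≤ t) (h1 : t ≤ 1) : |t * Real.log t| ≤ 1 := by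
  have h2 := Real.negMulLog_nonneg h0 h1
  have h3 := Real.negMulLog_le_one_sub_self h0
  unfold Real.negMulLog at h2 h3
  rw [abs_le]
  constructor <;> nlinarith

/-- The bound on `|t log t|`, applied at `√t` and squared. -/
theorem mul_log_sq_le_four {t : ℝ} (h0 : 0 ≤ t) (h1 : t ≤ 1) : t * Real.log t ^ 2 ≤ 4 := by
  have h2 := abs_mul_log_le_one (Real.sqrt_nonneg t) (Real.sqrt_le_one.mpr h1)
  rw [Real.log_sqrt h0] at h2
  have h3 : (√t * (Real.log t / 2)) ^ 2 ≤ 1 := by rw [← sq_abs]; nlinarith [abs_nonneg (√t * (Real.log t / 2))]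
  rw [mul_pow, Real.sq_sqrt h0] at h3
  nlinarith

/-- The ratio `v / r` lies between `v`, as `r ≤ 1`, and `1 / a`. In the uses, `a` is the mass of an
input letter and `r` an output density containing the term `a * v`. -/
theorem abs_log_div_le {a v r : ℝ} (ha : 0 < a) (hv : 0 < v) (hv1 : v ≤ 1) (hr : r ≤ 1)
    (h : a * v ≤ r) : |Real.log (v / r)| ≤ |Real.log a| + |Real.log v| := by
  have hr0 : 0 < r := lt_of_lt_of_le (by positivity) h
  rw [Real.log_div hv.ne' hr0.ne', abs_le]
  have h1 : Real.log r ≤ 0 := Real.log_nonpos hr0.le hr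
  have h2 : Real.log a + Real.log v ≤ Real.log r := by
    rw [← Real.log_mul ha.ne' hv.ne']; exact Real.log_le_log (by positivity) h
  have h3 : Real.log v ≤ 0 := Real.log_nonpos hv.le hv1
  have h4 := neg_abs_le (Real.log a)
  have h5 := abs_nonneg (Real.log a)
  rw [abs_of_nonpos h3]
  constructor <;> linarith

theorem abs_mul_log_div_le {a v r : ℝ} (ha : 0 < a) (hv : 0 ≤ v) (hv1 : v ≤ 1) (hr : r ≤ 1)
    (h : a * v ≤ r) : |v * Real.log (v / r)| ≤ |Real.log a| + 1 := by
  rcases hv.eq_or_lt with rfl | hv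
  · simp; positivity
  · have h1 := abs_log_div_le ha hv hv1 hr h
    have h2 := abs_mul_log_le_one hv.le hv1
    rw [abs_mul, abs_of_pos hv] at h2 ⊢
    nlinarith [abs_nonneg (Real.log a)]

theorem mul_log_div_sq_le {a v r : ℝ} (ha : 0 < a) (hv : 0 ≤ v) (hv1 : v ≤ 1) (hr : r ≤ 1)
    (h : a * v ≤ r) : v * Real.log (v / r) ^ 2 ≤ 2 * Real.log a ^ 2 + 8 := by
  rcases hv.eq_or_lt with rfl | hv
  · simp; positivity
  · have h1 := abs_log_div_le ha hv hv1 hr h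
    have h2 := mul_log_sq_le_four hv.le hv1
    have h3 : Real.log (v / r) ^ 2 ≤ 2 * Real.log a ^ 2 + 2 * Real.log v ^ 2 := by
      rw [← sq_abs, ← sq_abs (Real.log a), ← sq_abs (Real.log v)]
      nlinarith [abs_nonneg (Real.log (v / r)), sq_nonneg (|Real.log a| - |Real.log v|)]
    nlinarith [sq_nonneg (Real.log a)]

/-! ### Densities -/

section Density

variable {X Y : Type*} [MeasurableSpace Y] {m : Measure Y}

theorem integrable_of_abs_le {Z : Type*} [MeasurableSpace Z] {μ : Measure Z} [IsFiniteMeasure μ]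
    {f : Z → ℝ} (hf : Measurable f) {C : ℝ} (h : ∀ z, |f z| ≤ C) : Integrable f μ :=
  Integrable.of_bound hf.aestronglyMeasurable C (Filter.Eventually.of_forall h)

namespace IsDensityFamily

variable {v : X → Y → ℝ}

theorem abs_le_one (h : IsDensityFamily m v) (x : X) (y : Y) : |v x y| ≤ 1 := by
  rw [abs_of_nonneg (h.nonneg x y)]; exact h.le_one x y

theorem integrable [IsFiniteMeasure m] (h : IsDensityFamily m v) (x : X) : Integrable (v x) m :=
  integrable_of_abs_le (h.measurable x) (h.abs_le_one x)

theorem comp {X' : Type*} (h : IsDensityFamily m v) (f : X' → X) :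
    IsDensityFamily m fun x => v (f x) :=
  ⟨fun _ => h.measurable _, fun _ => h.nonneg _, fun _ => h.le_one _, fun _ => h.integral_eq_one _⟩

theorem mixture [IsFiniteMeasure m] {A : Type*} [Fintype A] {q : X → A → ℝ}
    {w : X → A → Y → ℝ} (h : ∀ x, IsDensityFamily m (w x)) (hq : ∀ x a, 0 ≤ q x a)
    (hq1 : ∀ x, ∑ a, q x a = 1) : IsDensityFamily m fun x y => ∑ a, q x a * w x a y where
  measurable x := Finset.measurable_sum _ fun a _ => ((h x).measurable a).const_mul _
  nonneg x y := Finset.sum_nonneg fun a _ => mul_nonneg (hq x a) ((h x).nonneg a y)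
  le_one x y := by
    rw [← hq1 x]
    exact Finset.sum_le_sum fun a _ => mul_le_of_le_one_right (hq x a) ((h x).le_one a y)
  integral_eq_one x := by
    rw [integral_finsetSum _ fun a _ => ((h x).integrable a).const_mul _, ← hq1 x]
    exact Finset.sum_congr rfl fun a _ => by
      rw [integral_const_mul, (h x).integral_eq_one, mul_one]

theorem lintegral_eq_one [IsFiniteMeasure m] (h : IsDensityFamily m v) (x : X) :
    ∫⁻ y, ENNReal.ofReal (v x y) ∂m = 1 := by
  rw [← ofReal_integral_eq_lintegral_ofReal (h.integrable x)
    (Filter.Eventually.of_forall (h.nonneg x)), h.integral_eq_one, ENNReal.ofReal_one]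

theorem isProbabilityMeasure [IsFiniteMeasure m] (h : IsDensityFamily m v) (x : X) :
    IsProbabilityMeasure (m.withDensity fun y => ENNReal.ofReal (v x y)) :=
  ⟨by rw [withDensity_apply _ MeasurableSet.univ, Measure.restrict_univ, h.lintegral_eq_one]⟩

theorem integral_withDensity (h : IsDensityFamily m v) (x : X) (f : Y → ℝ) :
    ∫ y, f y ∂(m.withDensity fun y => ENNReal.ofReal (v x y)) = ∫ y, v x y * f y ∂m := by
  rw [integral_withDensity_eq_integral_toReal_smul (h.measurable x).ennreal_ofReal
    (Filter.Eventually.of_forall fun _ => ENNReal.ofReal_lt_top)]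
  simp [ENNReal.toReal_ofReal (h.nonneg x _)]

end IsDensityFamily

/-- The sum of the laws dominates each of them setwise, so each Radon-Nikodym derivative is at most
`1` almost everywhere, and truncation makes this hold everywhere. Densities bounded by `1` on a
finite measure make the entropy integrands bounded, whatever the output space. -/
theorem exists_isDensityFamily [Fintype X] (κ : X → Measure Y) [∀ x, IsProbabilityMeasure (κ x)] :
    ∃ (m : Measure Y) (w : X → Y → ℝ), IsFiniteMeasure m ∧ IsDensityFamily m w ∧
      ∀ x, κ x = m.withDensity fun y => ENNReal.ofReal (w x y) := by
  let m : Measure Y := ∑ x, κ x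
  have hle : ∀ x, κ x ≤ m := fun x =>
    Finset.single_le_sum (f := κ) (fun _ _ => Measure.zero_le _) (Finset.mem_univ x)
  have hκ : ∀ x, κ x = m.withDensity fun y => ENNReal.ofReal (min 1 ((κ x).rnDeriv m y).toReal) := by
    intro x
    conv_lhs => rw [← Measure.withDensity_rnDeriv_eq (κ x) m (Measure.absolutelyContinuous_of_le (hle x))]
    refine withDensity_congr_ae ?_
    filter_upwards [Measure.rnDeriv_le_one_of_le (hle x)] with y hy
    have hy' : (κ x).rnDeriv m y ≤ 1 := hy
    have hne : (κ x).rnDeriv m y ≠ ∞ := (hy'.trans_lt ENNReal.one_lt_top).ne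
    rw [min_eq_right (by simpa using ENNReal.toReal_mono ENNReal.one_ne_top hy'),
      ENNReal.ofReal_toReal hne]
  have hmeas : ∀ x, Measurable fun y => min 1 ((κ x).rnDeriv m y).toReal := fun x =>
    measurable_const.min (Measure.measurable_rnDeriv _ _).ennreal_toReal
  have hnn : ∀ x y, 0 ≤ min 1 ((κ x).rnDeriv m y).toReal := fun x y => by positivity
  refine ⟨m, fun x y => min 1 ((κ x).rnDeriv m y).toReal, inferInstance,
    ⟨hmeas, hnn, fun x y => min_le_left _ _, fun x => ?_⟩, hκ⟩
  rw [integral_eq_lintegral_of_nonneg_ae (Filter.Eventually.of_forall (hnn x))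
    (hmeas x).aestronglyMeasurable]
  have h1 : κ x Set.univ = 1 := measure_univ
  rw [hκ x, withDensity_apply _ MeasurableSet.univ, Measure.restrict_univ] at h1
  rw [h1, ENNReal.toReal_one]

theorem withDensity_mixture {A : Type*} [Fintype A] {q : A → ℝ} {w : A → Y → ℝ}
    (h : IsDensityFamily m w) (hq : ∀ a, 0 ≤ q a) :
    ∑ a, ENNReal.ofReal (q a) • m.withDensity (fun y => ENNReal.ofReal (w a y)) =
      m.withDensity fun y => ENNReal.ofReal (∑ a, q a * w a y) := by
  ext s hs
  rw [withDensity_apply _ hs, Measure.finsetSum_apply]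
  simp only [Measure.smul_apply, smul_eq_mul, withDensity_apply _ hs]
  rw [show (fun y => ENNReal.ofReal (∑ a, q a * w a y)) =
    fun y => ∑ a, ENNReal.ofReal (q a) * ENNReal.ofReal (w a y) from ?_]
  · rw [lintegral_finsetSum _ fun a _ => ((h.measurable a).ennreal_ofReal).const_mul _]
    exact Finset.sum_congr rfl fun a _ =>
      (lintegral_const_mul _ (h.measurable a).ennreal_ofReal).symm
  · ext y
    rw [ENNReal.ofReal_sum_of_nonneg fun a _ => mul_nonneg (hq a) (h.nonneg a y)]
    exact Finset.sum_congr rfl fun a _ => ENNReal.ofReal_mul (hq a)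

theorem pi_withDensity {ι : Type*} [Fintype ι] [IsFiniteMeasure m] {v : ι → Y → ℝ}
    (h : IsDensityFamily m v) :
    Measure.pi (fun i => m.withDensity fun y => ENNReal.ofReal (v i y)) =
      (Measure.pi fun _ : ι => m).withDensity fun y => ENNReal.ofReal (∏ i, v i (y i)) := by
  have := h.isProbabilityMeasure
  have hint : ∀ s : ι → Set Y, (∀ i, MeasurableSet (s i)) →
      ∀ i, Integrable ((s i).indicator (v i)) m := fun s hs i => (h.integrable i).indicator (hs i)
  refine (Measure.pi_eq fun s hs => ?_)
  rw [withDensity_apply _ (MeasurableSet.univ_pi hs), ← lintegral_indicator (MeasurableSet.univ_pi hs)]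
  have h1 : ∀ y : ι → Y, (Set.univ.pi s).indicator (fun y => ENNReal.ofReal (∏ i, v i (y i))) y =
      ENNReal.ofReal (∏ i, (s i).indicator (v i) (y i)) := by
    intro y
    by_cases hy : y ∈ Set.univ.pi s
    · rw [Set.indicator_of_mem hy]
      congr 1
      exact Finset.prod_congr rfl fun i _ => (Set.indicator_of_mem (hy i trivial) _).symm
    · rw [Set.indicator_of_notMem hy]
      simp only [Set.mem_univ_pi, not_forall] at hy
      obtain ⟨i, hi⟩ := hy
      rw [Finset.prod_eq_zero (Finset.mem_univ i) (Set.indicator_of_notMem hi _), ENNReal.ofReal_zero]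
  simp_rw [h1]
  have hnn : ∀ i y, 0 ≤ (s i).indicator (v i) y := fun i y =>
    Set.indicator_nonneg (fun y _ => h.nonneg i y) y
  rw [← ofReal_integral_eq_lintegral_ofReal (Integrable.fintype_prod (hint s hs))
    (Filter.Eventually.of_forall fun y => Finset.prod_nonneg fun i _ => hnn i _),
    integral_fintype_prod_eq_prod, ENNReal.ofReal_prod_of_nonneg fun i _ => integral_nonneg (hnn i)]
  refine Finset.prod_congr rfl fun i _ => ?_
  rw [withDensity_apply _ (hs i), integral_indicator (hs i),
    ofReal_integral_eq_lintegral_ofReal (h.integrable i).integrableOn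
    (Filter.Eventually.of_forall (h.nonneg i))]

theorem measureReal_pi_withDensity {ι : Type*} [Fintype ι] [IsFiniteMeasure m] {v : ι → Y → ℝ}
    (h : IsDensityFamily m v) {A : Set (ι → Y)} (hA : MeasurableSet A) :
    (Measure.pi fun i => m.withDensity fun y => ENNReal.ofReal (v i y)).real A =
      ∫ y in A, ∏ i, v i (y i) ∂(Measure.pi fun _ : ι => m) := by
  rw [pi_withDensity h, measureReal_def, withDensity_apply _ hA,
    integral_eq_lintegral_of_nonneg_ae (Filter.Eventually.of_forall fun y =>
      Finset.prod_nonneg fun i _ => h.nonneg i _) (Integrable.fintype_prod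
        h.integrable).aestronglyMeasurable.restrict]

end Density

/-! ### Products of mixtures -/

/-- Independent inputs through independent channels give independent outputs, each with its averaged
law: expand the product of sums on boxes. It is used to average out states, random codewords and
random input pairs. -/
theorem pi_mixture {ι : Type*} [Fintype ι] {A : ι → Type*} [∀ i, Fintype (A i)]
    [∀ i, MeasurableSpace (A i)] [∀ i, MeasurableSingletonClass (A i)]
    {Y : Type*} [MeasurableSpace Y] (μ : ∀ i, Measure (A i)) [∀ i, IsProbabilityMeasure (μ i)]
    (κ : ∀ i, A i → Measure Y) [∀ i a, IsProbabilityMeasure (κ i a)]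
    (E : Set (ι → Y)) : ∫⁻ a, Measure.pi (fun i => κ i (a i)) E ∂Measure.pi μ =
      Measure.pi (fun i => ∑ a, μ i {a} • κ i a) E := by
  classical
  have hfin : ∀ i, IsFiniteMeasure (∑ a, μ i {a} • κ i a) := fun i => by
    refine ⟨?_⟩
    rw [Measure.finsetSum_apply]
    simp
  rw [lintegral_fintype]
  suffices Measure.pi (fun i => ∑ a, μ i {a} • κ i a) =
      ∑ a : (∀ i, A i), (∏ i, μ i {a i}) • Measure.pi (fun i => κ i (a i)) by
    rw [this, Measure.finsetSum_apply]
    simp only [Measure.smul_apply, smul_eq_mul, Measure.pi_singleton, mul_comm]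
  refine Measure.pi_eq fun s hs => ?_
  simp only [Measure.finsetSum_apply, Measure.smul_apply, smul_eq_mul, Measure.pi_pi]
  rw [Finset.prod_univ_sum, ← Fintype.piFinset_univ]
  exact Finset.sum_congr rfl fun a _ => Finset.prod_mul_distrib.symm

theorem lintegral_pi_eval {ι : Type*} [Fintype ι] {A : ι → Type*} [∀ i, MeasurableSpace (A i)]
    (μ : ∀ i, Measure (A i)) [∀ i, IsProbabilityMeasure (μ i)] (i : ι) {f : A i → ℝ≥0∞}
    (hf : Measurable f) : ∫⁻ a, f (a i) ∂Measure.pi μ = ∫⁻ x, f x ∂μ i :=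
  (measurePreserving_eval μ i).lintegral_comp hf

theorem lintegral_pi_eval_eval {ι : Type*} [Fintype ι] {A : ι → Type*} [∀ i, MeasurableSpace (A i)]
    (μ : ∀ i, Measure (A i)) [∀ i, IsProbabilityMeasure (μ i)] {i j : ι} (hij : i ≠ j)
    {f : A i → A j → ℝ≥0∞} (hf : Measurable (Function.uncurry f)) :
    ∫⁻ a, f (a i) (a j) ∂Measure.pi μ = ∫⁻ x, ∫⁻ y, f x y ∂μ j ∂μ i := by
  have hind : IndepFun (fun a : ∀ k, A k => a i) (fun a => a j) (Measure.pi μ) :=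
    (iIndepFun_pi (μ := μ) (X := fun _ => id) fun _ => aemeasurable_id).indepFun hij
  have hmap := (indepFun_iff_map_prod_eq_prod_map_map (measurable_pi_apply i).aemeasurable
    (measurable_pi_apply j).aemeasurable).1 hind
  change Measure.map _ _ = (Measure.map (Function.eval i) _).prod (Measure.map (Function.eval j) _) at hmap
  rw [(measurePreserving_eval μ i).map_eq, (measurePreserving_eval μ j).map_eq] at hmap
  have h1 := lintegral_map (μ := Measure.pi μ) (g := fun a : ∀ k, A k => (a i, a j)) hf (by fun_prop)
  rw [hmap, lintegral_prod _ hf.aemeasurable] at h1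
  exact h1.symm

theorem lintegral_pi_prod {ι : Type*} [Fintype ι] {A : ι → Type*} [∀ i, MeasurableSpace (A i)]
    (μ : ∀ i, Measure (A i)) [∀ i, IsProbabilityMeasure (μ i)] {f : ∀ i, A i → ℝ≥0∞}
    (hf : ∀ i, Measurable (f i)) : ∫⁻ a, ∏ i, f i (a i) ∂Measure.pi μ = ∏ i, ∫⁻ x, f i x ∂μ i := by
  rw [lintegral_prod_eq_prod_lintegral_of_indepFun Finset.univ (fun i (a : ∀ k, A k) => f i (a i))
    (iIndepFun_pi fun i => (hf i).aemeasurable) fun i => (hf i).comp (measurable_pi_apply i)]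
  exact Finset.prod_congr rfl fun i _ => lintegral_pi_eval μ i (hf i)

/-- Resampling one coordinate of an i.i.d. sequence. -/
theorem sum_prod_resample {ι S : Type*} [Fintype ι] [DecidableEq ι] [Fintype S] {q : S → ℝ}
    (hq : ∑ s, q s = 1) (i : ι) (F : (ι → S) → S → ℝ)
    (hF : ∀ s t u, F (Function.update s i t) u = F s u) :
    ∑ s : ι → S, (∏ j, q (s j)) * F s (s i) = ∑ s : ι → S, (∏ j, q (s j)) * ∑ t, q t * F s t := by
  have hsplit : ∀ (G : (ι → S) → ℝ), ∑ s, G s =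
      ∑ u : {j // j ≠ i} → S, ∑ t, G ((Equiv.funSplitAt i S).symm (t, u)) := by
    intro G
    rw [← (Equiv.funSplitAt i S).symm.sum_comp, Fintype.sum_prod_type, Finset.sum_comm]
  have hat : ∀ t u, (Equiv.funSplitAt i S).symm (t, u) i = t := by
    intro t u; simp [Equiv.funSplitAt, Equiv.piSplitAt]
  have hprod : ∀ t u, ∏ j, q ((Equiv.funSplitAt i S).symm (t, u) j) = q t * ∏ j, q (u j) := by
    intro t u
    rw [Fintype.prod_eq_mul_prod_subtype_ne _ i, hat]
    congr 1
    refine Finset.prod_congr rfl fun j _ => ?_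
    simp [Equiv.funSplitAt, Equiv.piSplitAt, j.2]
  have hFt : ∀ t t' u x, F ((Equiv.funSplitAt i S).symm (t, u)) x =
      F ((Equiv.funSplitAt i S).symm (t', u)) x := by
    intro t t' u x
    rw [← hF ((Equiv.funSplitAt i S).symm (t', u)) t x]
    congr 1
    ext j
    by_cases hj : j = i
    · subst hj; rw [hat, Function.update_self]
    · simp [Equiv.funSplitAt, Equiv.piSplitAt, hj]
  rw [hsplit, hsplit]
  refine Finset.sum_congr rfl fun u _ => ?_
  simp only [hprod, hat]
  rcases isEmpty_or_nonempty S with hS | ⟨⟨t₀⟩⟩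
  · simp
  · simp_rw [fun t x => hFt t t₀ u x]
    rw [← Finset.sum_mul, ← Finset.sum_mul, hq, one_mul, Finset.mul_sum]
    exact Finset.sum_congr rfl fun t _ => by ring

/-! ### Conditional information given a function of the input -/

section CondInfo

variable {X Γ Y : Type*} [Fintype X] [DecidableEq Γ] [MeasurableSpace Y]

/-- The law of `c` under the probability mass function `p`. -/
noncomputable def marginal (c : X → Γ) (p : X → ℝ) (γ : Γ) : ℝ := ∑ x with c x = γ, p x

/-- The density of the output given `c = γ`, for an input law `p`. -/
noncomputable def outputDensity (v : X → Y → ℝ) (c : X → Γ) (p : X → ℝ) (γ : Γ) (y : Y) : ℝ :=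
  (∑ x with c x = γ, p x * v x y) / marginal c p γ

/-- The conditional mutual information, in nats, of the input and the output given the value of `c`
at the input, for an input law `p`. -/
noncomputable def condInfo (m : Measure Y) (v : X → Y → ℝ) (c : X → Γ) (p : X → ℝ) : ℝ :=
  ∑ x, p x * ∫ y, v x y * Real.log (v x y / outputDensity v c p (c x) y) ∂m

variable {m : Measure Y} {v : X → Y → ℝ} {c : X → Γ} {p : X → ℝ}

theorem marginal_nonneg (hp : p ∈ stdSimplex ℝ X) (γ : Γ) : 0 ≤ marginal c p γ :=
  Finset.sum_nonneg fun x _ => hp.1 x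

theorem marginal_le_one (hp : p ∈ stdSimplex ℝ X) (γ : Γ) : marginal c p γ ≤ 1 := by
  rw [← hp.2]
  exact Finset.sum_le_sum_of_subset_of_nonneg (Finset.filter_subset _ _) fun x _ _ => hp.1 x

theorem le_marginal (hp : p ∈ stdSimplex ℝ X) (x : X) : p x ≤ marginal c p (c x) :=
  Finset.single_le_sum (f := p) (fun x _ => hp.1 x) (by simp)

theorem sum_fiber_nonneg (h : IsDensityFamily m v) (hp : p ∈ stdSimplex ℝ X) (γ : Γ) (y : Y) :
    0 ≤ ∑ x with c x = γ, p x * v x y :=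
  Finset.sum_nonneg fun x _ => mul_nonneg (hp.1 x) (h.nonneg x y)

theorem sum_fiber_le_marginal (h : IsDensityFamily m v) (hp : p ∈ stdSimplex ℝ X) (γ : Γ) (y : Y) :
    ∑ x with c x = γ, p x * v x y ≤ marginal c p γ :=
  Finset.sum_le_sum fun x _ => mul_le_of_le_one_right (hp.1 x) (h.le_one x y)

theorem le_sum_fiber (h : IsDensityFamily m v) (hp : p ∈ stdSimplex ℝ X) (x : X) (y : Y) :
    p x * v x y ≤ ∑ x' with c x' = c x, p x' * v x' y :=
  Finset.single_le_sum (f := fun x => p x * v x y)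
    (fun x _ => mul_nonneg (hp.1 x) (h.nonneg x y)) (by simp)

theorem outputDensity_nonneg (h : IsDensityFamily m v) (hp : p ∈ stdSimplex ℝ X) (γ : Γ) (y : Y) :
    0 ≤ outputDensity v c p γ y :=
  div_nonneg (sum_fiber_nonneg h hp γ y) (marginal_nonneg hp γ)

theorem outputDensity_le_one (h : IsDensityFamily m v) (hp : p ∈ stdSimplex ℝ X) (γ : Γ) (y : Y) :
    outputDensity v c p γ y ≤ 1 :=
  div_le_one_of_le₀ (sum_fiber_le_marginal h hp γ y) (marginal_nonneg hp γ)

/-- Dividing by a marginal at most `1` only increases the sum over the fibre. This is the hypothesis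
`a * v ≤ r` of the elementary logarithm bounds, with `a = p x`. -/
theorem le_outputDensity (h : IsDensityFamily m v) (hp : p ∈ stdSimplex ℝ X) {x : X}
    (hx : 0 < p x) (y : Y) : p x * v x y ≤ outputDensity v c p (c x) y := by
  rw [outputDensity, le_div_iff₀ (hx.trans_le (le_marginal hp x))]
  exact (mul_le_of_le_one_right (mul_nonneg (hp.1 x) (h.nonneg x y)) (marginal_le_one hp _)).trans
    (le_sum_fiber h hp x y)

theorem measurable_outputDensity (h : IsDensityFamily m v) (γ : Γ) :
    Measurable (outputDensity v c p γ) :=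
  (Finset.measurable_sum _ fun x _ => (h.measurable x).const_mul _).div_const _

theorem marginal_unit (hp : p ∈ stdSimplex ℝ X) (c : X → Unit) (γ : Unit) :
    marginal c p γ = 1 := by
  rw [marginal, Finset.filter_true_of_mem fun _ _ => Subsingleton.elim _ _, hp.2]

omit [MeasurableSpace Y] in
theorem outputDensity_unit (hp : p ∈ stdSimplex ℝ X) (c : X → Unit) (γ : Unit) (y : Y) :
    outputDensity v c p γ y = ∑ x, p x * v x y := by
  rw [outputDensity, marginal_unit hp, div_one,
    Finset.filter_true_of_mem fun _ _ => Subsingleton.elim _ _]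

/-! ### Continuity -/

/-- This is `h(Y, C) - H(C) - h(Y | X)`. Unlike the definition it contains no quotient, so it stays
manifestly continuous where a marginal vanishes; the terms with `p x = 0` vanish on their own. -/
theorem condInfo_eq [Fintype Γ] [IsFiniteMeasure m] (h : IsDensityFamily m v)
    (hp : p ∈ stdSimplex ℝ X) :
    condInfo m v c p = ∑ γ, (∫ y, Real.negMulLog (∑ x with c x = γ, p x * v x y) ∂m -
      Real.negMulLog (marginal c p γ)) - ∑ x, p x * ∫ y, Real.negMulLog (v x y) ∂m := by
  let N : Γ → Y → ℝ := fun γ y => ∑ x with c x = γ, p x * v x y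
  have hNm : ∀ γ, Measurable (N γ) := fun γ =>
    Finset.measurable_sum _ fun x _ => (h.measurable x).const_mul _
  have hN0 : ∀ γ y, 0 ≤ N γ y := fun γ y => sum_fiber_nonneg h hp γ y
  have hN1 : ∀ γ y, N γ y ≤ 1 := fun γ y =>
    (sum_fiber_le_marginal h hp γ y).trans (marginal_le_one hp γ)
  have hvm := h.measurable
  have hi1 : ∀ x, Integrable (fun y => Real.negMulLog (v x y)) m := fun x => by
    refine integrable_of_abs_le (Real.continuous_negMulLog.measurable.comp (hvm x)) (C := 1) ?_
    intro y
    rw [Real.negMulLog, neg_mul, abs_neg]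
    exact abs_mul_log_le_one (h.nonneg x y) (h.le_one x y)
  have hi2 : ∀ x, Integrable (fun y => p x * v x y * Real.log (N (c x) y)) m := fun x => by
    refine integrable_of_abs_le (((hvm x).const_mul _).mul (Real.measurable_log.comp (hNm _)))
      (C := 1) fun y => le_trans ?_ (abs_mul_log_le_one (hN0 (c x) y) (hN1 (c x) y))
    rw [abs_mul, abs_mul (N (c x) y), abs_of_nonneg (mul_nonneg (hp.1 x) (h.nonneg x y)),
      abs_of_nonneg (hN0 _ _)]
    exact mul_le_mul_of_nonneg_right (le_sum_fiber h hp x y) (abs_nonneg _)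
  have hterm : ∀ x, p x * ∫ y, v x y * Real.log (v x y / outputDensity v c p (c x) y) ∂m =
      -(∫ y, p x * v x y * Real.log (N (c x) y) ∂m) + p x * Real.log (marginal c p (c x)) -
        p x * ∫ y, Real.negMulLog (v x y) ∂m := by
    intro x
    rcases (hp.1 x).eq_or_lt with hx | hx
    · simp [← hx]
    have hM : 0 < marginal c p (c x) := hx.trans_le (le_marginal hp x)
    have hpt : ∀ y, p x * (v x y * Real.log (v x y / outputDensity v c p (c x) y)) =
        -(p x * v x y * Real.log (N (c x) y)) + p x * Real.log (marginal c p (c x)) * v x y -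
        p x * Real.negMulLog (v x y) := by
      intro y
      rcases (h.nonneg x y).eq_or_lt with hy | hy
      · simp [← hy]
      have hN : 0 < N (c x) y := (mul_pos hx hy).trans_le (le_sum_fiber h hp x y)
      have hNr : outputDensity v c p (c x) y = N (c x) y / marginal c p (c x) := rfl
      rw [hNr, Real.log_div hy.ne' (div_pos hN hM).ne', Real.log_div hN.ne' hM.ne', Real.negMulLog]
      ring
    rw [← integral_const_mul, integral_congr_ae (Filter.Eventually.of_forall hpt), integral_sub,
      integral_add, integral_neg, integral_const_mul, integral_const_mul, h.integral_eq_one, mul_one]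
    · exact (hi2 x).neg
    · exact (h.integrable x).const_mul _
    · exact (hi2 x).neg.add ((h.integrable x).const_mul _)
    · exact (hi1 x).const_mul _
  have hfib : ∀ γ, ∫ y, Real.negMulLog (N γ y) ∂m - Real.negMulLog (marginal c p γ) =
      ∑ x with c x = γ, (-(∫ y, p x * v x y * Real.log (N (c x) y) ∂m) +
        p x * Real.log (marginal c p (c x))) := by
    intro γ
    have h1 : ∀ x ∈ Finset.univ.filter (fun x => c x = γ),
        (-(∫ y, p x * v x y * Real.log (N (c x) y) ∂m) + p x * Real.log (marginal c p (c x))) =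
        -(∫ y, p x * v x y * Real.log (N γ y) ∂m) + p x * Real.log (marginal c p γ) := by
      intro x hx
      rw [(Finset.mem_filter.1 hx).2]
    rw [Finset.sum_congr rfl h1, Finset.sum_add_distrib, Finset.sum_neg_distrib, ← Finset.sum_mul,
      ← integral_finsetSum]
    · rw [← integral_neg, Real.negMulLog]
      simp only [← Finset.sum_mul]
      rw [show ∑ x with c x = γ, p x = marginal c p γ from rfl]
      simp only [Real.negMulLog, N]
      rw [neg_mul, sub_neg_eq_add]
      congr 1
      exact integral_congr_ae (Filter.Eventually.of_forall fun y => by ring)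
    · intro x hx
      have := hi2 x
      rwa [(Finset.mem_filter.1 hx).2] at this
  rw [condInfo, Finset.sum_congr rfl fun x _ => hterm x, Finset.sum_sub_distrib]
  congr 1
  change _ = ∑ γ, (∫ y, Real.negMulLog (N γ y) ∂m - Real.negMulLog (marginal c p γ))
  rw [Finset.sum_congr rfl fun γ _ => hfib γ, Finset.sum_fiberwise]

theorem continuousOn_condInfo [Fintype Γ] [IsFiniteMeasure m] (h : IsDensityFamily m v)
    (c : X → Γ) : ContinuousOn (condInfo m v c) (stdSimplex ℝ X) := by
  refine ContinuousOn.congr (f := fun p =>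
    ∑ γ, (∫ y, Real.negMulLog (∑ x with c x = γ, p x * v x y) ∂m -
      Real.negMulLog (marginal c p γ)) - ∑ x, p x * ∫ y, Real.negMulLog (v x y) ∂m) ?_
    fun p hp => condInfo_eq h hp
  refine ContinuousOn.sub (continuousOn_finsetSum _ fun γ _ => ContinuousOn.sub ?_ ?_) ?_
  · refine continuousOn_of_dominated (bound := fun _ => 1) ?_ ?_ (integrable_const _) ?_
    · intro p _
      exact (Real.continuous_negMulLog.measurable.comp
        (Finset.measurable_sum _ fun x _ => (h.measurable x).const_mul _)).aestronglyMeasurable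
    · intro p hp
      refine Filter.Eventually.of_forall fun y => ?_
      rw [Real.negMulLog, neg_mul, norm_neg, Real.norm_eq_abs]
      exact abs_mul_log_le_one (sum_fiber_nonneg h hp γ y)
        ((sum_fiber_le_marginal h hp γ y).trans (marginal_le_one hp γ))
    · refine Filter.Eventually.of_forall fun y => Continuous.continuousOn ?_
      exact Real.continuous_negMulLog.comp (by fun_prop)
  · exact (Real.continuous_negMulLog.comp (by unfold marginal; fun_prop)).continuousOn
  · exact Continuous.continuousOn (by fun_prop)

end CondInfo

/-! ### The Kullback-Leibler divergence between a joint law and the product of its marginals -/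

section JointLaw

variable {A Y : Type*} [Fintype A] [MeasurableSpace A] [MeasurableSingletonClass A]
  [MeasurableSpace Y] {m : Measure Y} {v : A → Y → ℝ} {p : A → ℝ}

/-- The joint law of the input and the output. -/
noncomputable def jointLaw (m : Measure Y) (v : A → Y → ℝ) (p : A → ℝ) : Measure (A × Y) :=
  ∑ a, ENNReal.ofReal (p a) • (m.withDensity fun y => ENNReal.ofReal (v a y)).map (Prod.mk a)

omit [MeasurableSingletonClass A] in
theorem jointLaw_apply (m : Measure Y) (v : A → Y → ℝ) (p : A → ℝ) {E : Set (A × Y)}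
    (hE : MeasurableSet E) :
    jointLaw m v p E = ∑ a, ENNReal.ofReal (p a) *
      (m.withDensity fun y => ENNReal.ofReal (v a y)) (Prod.mk a ⁻¹' E) := by
  rw [jointLaw, Measure.finsetSum_apply]
  refine Finset.sum_congr rfl fun a _ => ?_
  rw [Measure.smul_apply, smul_eq_mul, Measure.map_apply measurable_prodMk_left hE]

omit [MeasurableSingletonClass A] in
theorem isProbabilityMeasure_jointLaw [IsFiniteMeasure m] (h : IsDensityFamily m v)
    (hp : p ∈ stdSimplex ℝ A) : IsProbabilityMeasure (jointLaw m v p) := by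
  have := h.isProbabilityMeasure
  refine ⟨?_⟩
  rw [jointLaw_apply m v p MeasurableSet.univ]
  simp only [Set.preimage_univ, measure_univ, mul_one]
  rw [← ENNReal.ofReal_sum_of_nonneg fun a _ => hp.1 a, hp.2, ENNReal.ofReal_one]

omit [MeasurableSingletonClass A] in
theorem integrable_jointLaw (h : IsDensityFamily m v) {f : A × Y → ℝ} (hf : Measurable f)
    (hi : ∀ a, 0 < p a → Integrable (fun y => v a y * f (a, y)) m) :
    Integrable f (jointLaw m v p) := by
  rw [jointLaw, integrable_finsetSum_measure]
  intro a _
  rcases le_or_gt (p a) 0 with hpa | hpa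
  · simp [ENNReal.ofReal_of_nonpos hpa]
  · refine Integrable.smul_measure ?_ ENNReal.ofReal_ne_top
    rw [integrable_map_measure hf.aestronglyMeasurable measurable_prodMk_left.aemeasurable,
      integrable_withDensity_iff_integrable_smul' (h.measurable a).ennreal_ofReal
        (Filter.Eventually.of_forall fun _ => ENNReal.ofReal_lt_top)]
    simpa [ENNReal.toReal_ofReal (h.nonneg a _)] using hi a hpa

omit [MeasurableSingletonClass A] in
theorem integral_jointLaw (h : IsDensityFamily m v) (hp : ∀ a, 0 ≤ p a) {f : A × Y → ℝ}
    (hf : Measurable f) (hi : ∀ a, 0 < p a → Integrable (fun y => v a y * f (a, y)) m) :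
    ∫ z, f z ∂jointLaw m v p = ∑ a, p a * ∫ y, v a y * f (a, y) ∂m := by
  have hI := integrable_jointLaw h hf hi
  rw [jointLaw, integrable_finsetSum_measure] at hI
  rw [jointLaw, integral_finsetSum_measure hI]
  refine Finset.sum_congr rfl fun a _ => ?_
  rw [integral_smul_measure, integral_map measurable_prodMk_left.aemeasurable
    hf.aestronglyMeasurable, h.integral_withDensity, ENNReal.toReal_ofReal (hp a), smul_eq_mul]

/-- The joint law has density `v / r` with respect to the product of its marginals, `r` being the
output density, and the logarithm of this ratio is integrable. Nonnegativity is recorded because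
`ENNReal.ofReal` would hide a negative value when conditional terms are summed. -/
theorem klDiv_jointLaw [IsFiniteMeasure m] (h : IsDensityFamily m v) (hp : p ∈ stdSimplex ℝ A) :
    0 ≤ condInfo m v (fun _ => ()) p ∧
    klDiv (jointLaw m v p) (((jointLaw m v p).map Prod.fst).prod ((jointLaw m v p).map Prod.snd)) =
      ENNReal.ofReal (condInfo m v (fun _ => ()) p) := by
  have hprob := isProbabilityMeasure_jointLaw h hp
  set μ := jointLaw m v p with hμ
  let r : Y → ℝ := outputDensity v (fun _ : A => ()) p ()
  have hr : ∀ y, r y = ∑ a, p a * v a y := fun y => outputDensity_unit hp _ _ y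
  have hrm : Measurable r := measurable_outputDensity h _
  have hr0 : ∀ y, 0 ≤ r y := fun y => outputDensity_nonneg h hp _ y
  have hfst : ∀ a, μ.map Prod.fst {a} = ENNReal.ofReal (p a) := by
    classical
    intro a
    have := h.isProbabilityMeasure
    rw [Measure.map_apply measurable_fst (MeasurableSet.singleton a),
      jointLaw_apply m v p (measurable_fst (MeasurableSet.singleton a)),
      Finset.sum_eq_single a]
    · rw [show Prod.mk a ⁻¹' (Prod.fst ⁻¹' {a}) = (Set.univ : Set Y) by ext; simp, measure_univ, mul_one]
    · intro b _ hb
      rw [show Prod.mk b ⁻¹' (Prod.fst ⁻¹' {a}) = (∅ : Set Y) by ext; simp [hb], measure_empty, mul_zero]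
    · simp
  have hsnd : μ.map Prod.snd = m.withDensity fun y => ENNReal.ofReal (r y) := by
    simp_rw [hr]
    rw [← withDensity_mixture h hp.1]
    ext s hs
    rw [Measure.map_apply measurable_snd hs, jointLaw_apply m v p (measurable_snd hs),
      Measure.finsetSum_apply]
    rfl
  set ν := (μ.map Prod.fst).prod (μ.map Prod.snd) with hν
  have hp1 : IsProbabilityMeasure (μ.map Prod.fst) := Measure.isProbabilityMeasure_map (by fun_prop)
  have hp2 : IsProbabilityMeasure (μ.map Prod.snd) := Measure.isProbabilityMeasure_map (by fun_prop)
  let L : A × Y → ℝ := fun z => v z.1 z.2 / r z.2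
  have hvm : Measurable fun z : A × Y => v z.1 z.2 := measurable_from_prod_countable_right h.measurable
  have hL : Measurable L := hvm.div (hrm.comp measurable_snd)
  have hμν : μ = ν.withDensity fun z => ENNReal.ofReal (L z) := by
    ext E hE
    rw [withDensity_apply _ hE, ← lintegral_indicator hE, hν,
      lintegral_prod _ (hL.ennreal_ofReal.indicator hE).aemeasurable, lintegral_fintype, hμ,
      jointLaw_apply m v p hE]
    refine Finset.sum_congr rfl fun a _ => ?_
    rw [← hμ, hfst, mul_comm, hsnd]
    rcases (hp.1 a).eq_or_lt with hpa | hpa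
    · simp [← hpa]
    congr 1
    have hEa : MeasurableSet (Prod.mk a ⁻¹' E) := measurable_prodMk_left hE
    rw [withDensity_apply _ hEa, ← lintegral_indicator hEa]
    have hmul := lintegral_withDensity_eq_lintegral_mul m hrm.ennreal_ofReal
      ((hL.ennreal_ofReal.indicator hE).comp (measurable_prodMk_left (x := a)))
    simp only [Function.comp_def] at hmul
    rw [hmul]
    refine lintegral_congr fun y => ?_
    by_cases hy : (a, y) ∈ E
    · rw [Set.indicator_of_mem (show y ∈ Prod.mk a ⁻¹' E from hy), Pi.mul_apply,
        Set.indicator_of_mem hy, ← ENNReal.ofReal_mul (hr0 y)]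
      congr 1
      -- Where `r y = 0`, the bound `p a * v a y ≤ r y` with `p a > 0` forces `v a y = 0`, so the
      -- default value of the division does no harm.
      rcases (hr0 y).eq_or_lt with h0 | h0
      · have h3 : p a * v a y ≤ r y := le_outputDensity (c := fun _ => ()) h hp hpa y
        rw [← h0, zero_mul]
        have h4 := h.nonneg a y
        nlinarith
      · exact (mul_div_cancel₀ _ h0.ne').symm
    · rw [Set.indicator_of_notMem (show y ∉ Prod.mk a ⁻¹' E from hy), Pi.mul_apply,
        Set.indicator_of_notMem hy, mul_zero]
  have hac : μ ≪ ν := by rw [hμν]; exact withDensity_absolutelyContinuous _ _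
  have hllr : llr μ ν =ᵐ[μ] fun z => Real.log (L z) := by
    refine hac.ae_eq ?_
    have := Measure.rnDeriv_withDensity ν hL.ennreal_ofReal
    rw [← hμν] at this
    filter_upwards [this] with z hz
    rw [llr, hz, ENNReal.toReal_ofReal (div_nonneg (h.nonneg _ _) (hr0 _))]
  have hint : ∀ a, 0 < p a → Integrable (fun y => v a y * Real.log (L (a, y))) m := by
    intro a hpa
    refine integrable_of_abs_le ((h.measurable a).mul (Real.measurable_log.comp
      (hL.comp measurable_prodMk_left))) (C := |Real.log (p a)| + 1) fun y => ?_
    exact abs_mul_log_div_le hpa (h.nonneg a y) (h.le_one a y) (outputDensity_le_one h hp _ y)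
      (le_outputDensity (c := fun _ => ()) h hp hpa y)
  have hLm : Measurable fun z => Real.log (L z) := Real.measurable_log.comp hL
  have hI : Integrable (llr μ ν) μ := (integrable_congr hllr).2 (integrable_jointLaw h hLm hint)
  have hval : ∫ z, llr μ ν z ∂μ = condInfo m v (fun _ => ()) p := by
    rw [integral_congr_ae hllr, hμ, integral_jointLaw h hp.1 hLm hint]
    rfl
  have htoReal := toReal_klDiv_of_measure_eq hac (by simp)
  rw [hval] at htoReal
  exact ⟨htoReal ▸ ENNReal.toReal_nonneg,
    by rw [← htoReal, ENNReal.ofReal_toReal (klDiv_ne_top hac hI)]⟩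

end JointLaw

theorem real_singleton_mem_stdSimplex {A : Type*} [Fintype A] [MeasurableSpace A]
    [MeasurableSingletonClass A] (P : Measure A) [IsProbabilityMeasure P] :
    (fun a => P.real {a}) ∈ stdSimplex ℝ A := by
  refine ⟨fun a => measureReal_nonneg, ?_⟩
  rw [sum_measureReal_singleton, Finset.coe_univ, probReal_univ]

/-- The densities of the outputs of the channel averaged over the state. -/
noncomputable def avgDensity {X S Y : Type*} [Fintype S] (q : S → ℝ) (w : X × S → Y → ℝ) (x : X)
    (y : Y) : ℝ := ∑ s, q s * w (x, s) y

theorem avgDensity_isDensityFamily {X S Y : Type*} [Fintype S] [MeasurableSpace Y] {m : Measure Y}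
    [IsFiniteMeasure m] {q : S → ℝ} {w : X × S → Y → ℝ} (hw : IsDensityFamily m w)
    (hq : q ∈ stdSimplex ℝ S) : IsDensityFamily m (avgDensity q w) :=
  IsDensityFamily.mixture (q := fun _ => q) (fun x => hw.comp fun s => (x, s)) (fun _ => hq.1)
    fun _ => hq.2

theorem sum_fiber_snd {X₁ X₂ M : Type*} [Fintype X₁] [Fintype X₂] [DecidableEq X₂]
    [AddCommMonoid M] (f : X₁ × X₂ → M) (b : X₂) :
    ∑ x with Prod.snd x = b, f x = ∑ a, f (a, b) := by
  rw [Finset.sum_filter, Fintype.sum_prod_type]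
  simp

/-! ### Single-letter mutual informations as density integrals -/

section Bridge

variable {S X₁ X₂ Y : Type*}
    [Fintype S] [MeasurableSpace S] [MeasurableSingletonClass S]
    [Fintype X₁] [MeasurableSpace X₁] [MeasurableSingletonClass X₁]
    [Fintype X₂] [MeasurableSpace X₂] [MeasurableSingletonClass X₂]
    [MeasurableSpace Y]
    {Q : Measure S} [IsProbabilityMeasure Q]
    {W : Kernel ((X₁ × X₂) × S) Y} [IsMarkovKernel W]
    {m : Measure Y} [IsFiniteMeasure m] {w : (X₁ × X₂) × S → Y → ℝ}

omit [MeasurableSingletonClass S] [Fintype X₁] [MeasurableSingletonClass X₁] [Fintype X₂]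
  [MeasurableSingletonClass X₂] [IsMarkovKernel W] [IsFiniteMeasure m] in
theorem sum_smul_channel (hw : IsDensityFamily m w)
    (hW : ∀ z, W z = m.withDensity fun y => ENNReal.ofReal (w z y)) (x : X₁ × X₂) :
    ∑ s, Q {s} • W (x, s) =
      m.withDensity fun y => ENNReal.ofReal (avgDensity (fun s => Q.real {s}) w x y) := by
  unfold avgDensity
  rw [← withDensity_mixture (hw.comp fun s => (x, s)) fun s => measureReal_nonneg]
  refine Finset.sum_congr rfl fun s _ => ?_
  rw [hW, ofReal_measureReal]

omit [IsFiniteMeasure m] in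
-- Forgetting an independent state replaces the channel by its average over the state. Hence the
-- informations in the region depend on `Q` and `W` through `avgDensity` only.
theorem map_compProd_eq_jointLaw (hw : IsDensityFamily m w)
    (hW : ∀ z, W z = m.withDensity fun y => ENNReal.ofReal (w z y))
    (P : Measure (X₁ × X₂)) [IsProbabilityMeasure P] :
    ((P.prod Q).compProd W).map (fun ω => (ω.1.1, ω.2)) =
      jointLaw m (avgDensity (fun s => Q.real {s}) w) fun x => P.real {x} := by
  ext E hE
  have hmeas : Measurable fun ω : ((X₁ × X₂) × S) × Y => (ω.1.1, ω.2) := by fun_prop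
  rw [Measure.map_apply hmeas hE, Measure.compProd_apply (hmeas hE), jointLaw_apply _ _ _ hE,
    lintegral_fintype, Fintype.sum_prod_type]
  refine Finset.sum_congr rfl fun x _ => ?_
  rw [← sum_smul_channel hw hW x, Measure.finsetSum_apply, ofReal_measureReal, Finset.mul_sum]
  refine Finset.sum_congr rfl fun s _ => ?_
  rw [← Set.singleton_prod_singleton, Measure.prod_prod, Measure.smul_apply, smul_eq_mul]
  rw [mul_comm, mul_assoc]
  rfl

theorem mutualInfo_compProd (hw : IsDensityFamily m w)
    (hW : ∀ z, W z = m.withDensity fun y => ENNReal.ofReal (w z y))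
    (P : Measure (X₁ × X₂)) [IsProbabilityMeasure P] :
    mutualInfo ((P.prod Q).compProd W) (fun ω => ω.1.1) (fun ω => ω.2) =
      ENNReal.ofReal (condInfo m (avgDensity (fun s => Q.real {s}) w) (fun _ => ())
        (fun x => P.real {x}) / Real.log 2) := by
  have hv := avgDensity_isDensityFamily hw (real_singleton_mem_stdSimplex Q)
  have hmap := map_compProd_eq_jointLaw (Q := Q) hw hW P
  have hfst : ((P.prod Q).compProd W).map (fun ω => ω.1.1) =
      (jointLaw m (avgDensity (fun s => Q.real {s}) w) fun x => P.real {x}).map Prod.fst := by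
    rw [← hmap, Measure.map_map (by fun_prop) (by fun_prop)]; rfl
  have hsnd : ((P.prod Q).compProd W).map (fun ω => ω.2) =
      (jointLaw m (avgDensity (fun s => Q.real {s}) w) fun x => P.real {x}).map Prod.snd := by
    rw [← hmap, Measure.map_map (by fun_prop) (by fun_prop)]; rfl
  rw [mutualInfo, hmap, hfst, hsnd, (klDiv_jointLaw hv (real_singleton_mem_stdSimplex P)).2,
    ENNReal.ofReal_div_of_pos (Real.log_pos one_lt_two)]

omit [MeasurableSpace X₁] [MeasurableSingletonClass X₁] [MeasurableSpace X₂]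
  [MeasurableSingletonClass X₂] [IsFiniteMeasure m] in
-- Group the inputs by their second coordinate. A letter of zero mass contributes `0` to both sides,
-- whatever its default conditional law.
theorem condInfo_snd [DecidableEq X₂] {v : X₁ × X₂ → Y → ℝ} {p : X₁ × X₂ → ℝ}
    (hp : p ∈ stdSimplex ℝ (X₁ × X₂)) :
    condInfo m v Prod.snd p = ∑ b, marginal Prod.snd p b *
      condInfo m (fun a => v (a, b)) (fun _ => ()) fun a => p (a, b) / marginal Prod.snd p b := by
  rw [condInfo, Fintype.sum_prod_type_right]
  refine Finset.sum_congr rfl fun b _ => ?_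
  have hmarg : marginal Prod.snd p b = ∑ a, p (a, b) := sum_fiber_snd p b
  rcases (marginal_nonneg (c := Prod.snd) hp b).eq_or_lt with h0 | h0
  · rw [← h0, zero_mul]
    refine Finset.sum_eq_zero fun a _ => ?_
    have h1 := le_marginal (c := Prod.snd) hp (a, b)
    have h2 := hp.1 (a, b)
    rw [show p (a, b) = 0 by linarith [h0.symm ▸ h1], zero_mul]
  · have hpb : (fun a => p (a, b) / marginal Prod.snd p b) ∈ stdSimplex ℝ X₁ := by
      refine ⟨fun a => div_nonneg (hp.1 _) h0.le, ?_⟩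
      rw [← Finset.sum_div, ← hmarg, div_self h0.ne']
    rw [condInfo, Finset.mul_sum]
    refine Finset.sum_congr rfl fun a _ => ?_
    rw [← mul_assoc, mul_div_cancel₀ _ h0.ne']
    congr 2
    ext y
    rw [outputDensity_unit hpb, outputDensity, sum_fiber_snd (fun x => p x * v x y), Finset.sum_div]
    congr 3
    exact Finset.sum_congr rfl fun a _ => by ring

theorem condMutualInfo_compProd [DecidableEq X₂] (hw : IsDensityFamily m w)
    (hW : ∀ z, W z = m.withDensity fun y => ENNReal.ofReal (w z y))
    (P : Measure (X₁ × X₂)) [IsProbabilityMeasure P] :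
    condMutualInfo ((P.prod Q).compProd W) (fun ω => ω.1.1.1) (fun ω => ω.2) (fun ω => ω.1.1.2) =
      ENNReal.ofReal (condInfo m (avgDensity (fun s => Q.real {s}) w) Prod.snd
        (fun x => P.real {x}) / Real.log 2) := by
  have hv := avgDensity_isDensityFamily hw (real_singleton_mem_stdSimplex Q)
  have hp := real_singleton_mem_stdSimplex P
  have hmap := map_compProd_eq_jointLaw (Q := Q) hw hW P
  set p : X₁ × X₂ → ℝ := fun x => P.real {x} with hpdef
  set v := avgDensity (fun s => Q.real {s}) w with hvdef
  set μ := (P.prod Q).compProd W with hμ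
  have hm : Measurable fun ω : ((X₁ × X₂) × S) × Y => (ω.1.1, ω.2) := by fun_prop
  have hm1 : Measurable fun ω : ((X₁ × X₂) × S) × Y => (ω.1.1.1, ω.2) := by fun_prop
  have hprob := hv.isProbabilityMeasure
  have hevent : ∀ b (E : Set (X₁ × Y)), MeasurableSet E →
      μ ((fun ω => ω.1.1.2) ⁻¹' {b} ∩ (fun ω => (ω.1.1.1, ω.2)) ⁻¹' E) =
      ∑ a, ENNReal.ofReal (p (a, b)) *
        (m.withDensity fun y => ENNReal.ofReal (v (a, b) y)) (Prod.mk a ⁻¹' E) := by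
    intro b E hE
    have hF : MeasurableSet {z : (X₁ × X₂) × Y | z.1.2 = b ∧ (z.1.1, z.2) ∈ E} := by
      refine MeasurableSet.inter ?_ ?_
      · exact (measurable_snd.comp measurable_fst) (MeasurableSet.singleton b)
      · exact (show Measurable fun z : (X₁ × X₂) × Y => (z.1.1, z.2) by fun_prop) hE
    have := jointLaw_apply m v p hF
    rw [← hmap, Measure.map_apply hm hF] at this
    refine Eq.trans ?_ (this.trans ?_)
    · rfl
    · rw [Fintype.sum_prod_type]
      refine Finset.sum_congr rfl fun a _ => ?_
      rw [Finset.sum_eq_single b]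
      · congr 2
        ext y; simp
      · intro b' _ hb'
        rw [show Prod.mk (a, b') ⁻¹' {z : (X₁ × X₂) × Y | z.1.2 = b ∧ (z.1.1, z.2) ∈ E} = ∅ by
          ext y; simp [hb'], measure_empty, mul_zero]
      · simp
  have hevent1 : ∀ b, μ ((fun ω => ω.1.1.2) ⁻¹' {b}) = ENNReal.ofReal (marginal Prod.snd p b) := by
    intro b
    have := hevent b Set.univ MeasurableSet.univ
    simp only [Set.preimage_univ, Set.inter_univ, measure_univ, mul_one] at this
    rw [this, marginal, sum_fiber_snd, ENNReal.ofReal_sum_of_nonneg fun a _ => hp.1 _]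
  have hpb : ∀ b, 0 < marginal Prod.snd p b →
      (fun a => p (a, b) / marginal Prod.snd p b) ∈ stdSimplex ℝ X₁ := by
    intro b h0
    refine ⟨fun a => div_nonneg (hp.1 _) h0.le, ?_⟩
    rw [← Finset.sum_div, marginal, sum_fiber_snd, div_self]
    rw [marginal, sum_fiber_snd] at h0
    exact h0.ne'
  have hcond : ∀ b, 0 < marginal Prod.snd p b →
      (ProbabilityTheory.cond μ ((fun ω => ω.1.1.2) ⁻¹' {b})).map (fun ω => (ω.1.1.1, ω.2)) =
      jointLaw m (fun a => v (a, b)) fun a => p (a, b) / marginal Prod.snd p b := by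
    intro b h0
    ext E hE
    rw [Measure.map_apply hm1 hE, ProbabilityTheory.cond_apply
      ((show Measurable fun ω : ((X₁ × X₂) × S) × Y => ω.1.1.2 by fun_prop)
        (MeasurableSet.singleton b)), hevent b E hE, hevent1, jointLaw_apply _ _ _ hE,
      Finset.mul_sum]
    refine Finset.sum_congr rfl fun a _ => ?_
    rw [ENNReal.ofReal_div_of_pos h0, ← mul_assoc, ENNReal.div_eq_inv_mul]
  have hlog := Real.log_pos one_lt_two
  have hterm : ∀ b, μ ((fun ω => ω.1.1.2) ⁻¹' {b}) *
      mutualInfo (ProbabilityTheory.cond μ ((fun ω => ω.1.1.2) ⁻¹' {b})) (fun ω => ω.1.1.1)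
        (fun ω => ω.2) = ENNReal.ofReal (marginal Prod.snd p b * condInfo m (fun a => v (a, b))
          (fun _ => ()) (fun a => p (a, b) / marginal Prod.snd p b) / Real.log 2) := by
    intro b
    rw [hevent1]
    rcases (marginal_nonneg (c := Prod.snd) hp b).eq_or_lt with h0 | h0
    · simp [← h0]
    have hfst : (ProbabilityTheory.cond μ ((fun ω => ω.1.1.2) ⁻¹' {b})).map (fun ω => ω.1.1.1) =
        (jointLaw m (fun a => v (a, b)) fun a => p (a, b) / marginal Prod.snd p b).map Prod.fst := by
      rw [← hcond b h0, Measure.map_map (by fun_prop) (by fun_prop)]; rfl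
    have hsnd : (ProbabilityTheory.cond μ ((fun ω => ω.1.1.2) ⁻¹' {b})).map (fun ω => ω.2) =
        (jointLaw m (fun a => v (a, b)) fun a => p (a, b) / marginal Prod.snd p b).map Prod.snd := by
      rw [← hcond b h0, Measure.map_map (by fun_prop) (by fun_prop)]; rfl
    rw [mutualInfo, hcond b h0, hfst, hsnd, (klDiv_jointLaw (hv.comp fun a => (a, b)) (hpb b h0)).2,
      mul_div_assoc, ENNReal.ofReal_mul h0.le, ENNReal.ofReal_div_of_pos hlog]
  rw [condMutualInfo, Finset.sum_congr rfl fun b _ => hterm b, ← ENNReal.ofReal_sum_of_nonneg,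
    ← Finset.sum_div, ← condInfo_snd hp]
  intro b _
  rcases (marginal_nonneg (c := Prod.snd) hp b).eq_or_lt with h0 | h0
  · simp [← h0]
  · exact div_nonneg (mul_nonneg h0.le
      (klDiv_jointLaw (hv.comp fun a => (a, b)) (hpb b h0)).1) hlog.le

end Bridge

/-! ### Converse: change of measure under causal state dependence -/

/-- Summing out a product of nonnegative factors, the `i`-th of which depends on the first `i + 1`
coordinates only, starting from the last coordinate. -/
theorem sum_prod_causal_le {S : Type*} [Fintype S] (n : ℕ)
    (a : (i : Fin n) → (Fin i.val → S) → S → ℝ) (b : Fin n → ℝ)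
    (ha : ∀ i u t, 0 ≤ a i u t) (hb : ∀ i, 0 ≤ b i) (hab : ∀ i u, ∑ t, a i u t ≤ b i) :
    ∑ s : Fin n → S, ∏ i, a i (fun j => s (Fin.castLE i.isLt.le j)) (s i) ≤ ∏ i, b i := by
  induction n with
  | zero => simp
  | succ n ih =>
    have hsnoc : ∀ (G : (Fin (n + 1) → S) → ℝ), ∑ s, G s =
        ∑ s : Fin n → S, ∑ t, G (Fin.snoc (α := fun _ => S) s t) := by
      intro G
      rw [← (Fin.snocEquiv fun _ => S).sum_comp, Fintype.sum_prod_type, Finset.sum_comm]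
      rfl
    rw [hsnoc, Fin.prod_univ_castSucc]
    have hterm : ∀ (s : Fin n → S) (t : S),
        ∏ i : Fin (n + 1), a i (fun j => (Fin.snoc (α := fun _ => S) s t : Fin (n + 1) → S)
          (Fin.castLE i.isLt.le j)) ((Fin.snoc (α := fun _ => S) s t : Fin (n + 1) → S) i) =
        (∏ i : Fin n, a i.castSucc (fun j => s (Fin.castLE i.isLt.le j)) (s i)) *
          a (Fin.last n) s t := by
      intro s t
      rw [Fin.prod_univ_castSucc]
      congr 1
      · refine Finset.prod_congr rfl fun i _ => ?_
        rw [Fin.snoc_castSucc]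
        congr 1
        ext j
        exact Fin.snoc_castSucc (α := fun _ => S) t s (Fin.castLE i.isLt.le j)
      · rw [Fin.snoc_last]
        congr 1
        ext j
        exact Fin.snoc_castSucc (α := fun _ => S) t s j
    simp_rw [hterm, ← Finset.mul_sum]
    calc _ ≤ ∑ s : Fin n → S,
          (∏ i : Fin n, a i.castSucc (fun j => s (Fin.castLE i.isLt.le j)) (s i)) * b (Fin.last n) :=
          Finset.sum_le_sum fun s _ => mul_le_mul_of_nonneg_left (hab _ _)
            (Finset.prod_nonneg fun i _ => ha _ _ _)
      _ ≤ _ := by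
          rw [← Finset.sum_mul]
          exact mul_le_mul_of_nonneg_right (ih (fun i => a i.castSucc) (fun i => b i.castSucc)
            (fun i => ha i.castSucc) (fun i => hb _) fun i => hab i.castSucc) (hb _)

theorem sum_prod_eq_one {ι S : Type*} [Fintype ι] [DecidableEq ι] [Fintype S] {q : S → ℝ}
    (hq : ∑ s, q s = 1) : ∑ s : ι → S, ∏ j, q (s j) = 1 := by
  have := Finset.prod_univ_sum (fun _ : ι => (Finset.univ : Finset S)) fun _ s => q s
  simp only [hq, Finset.prod_const_one, Fintype.piFinset_univ] at this
  exact this.symm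

section Converse

variable {S X Γ Y K : Type*} [Fintype S] [Fintype X] [DecidableEq X] [DecidableEq Γ]
  [MeasurableSpace Y] [Fintype K]
  {m : Measure Y} [IsFiniteMeasure m] {q : S → ℝ} {w : X × S → Y → ℝ} {n : ℕ}

/-- The input at time `i` for the message `k` and the state sequence `s`, when it depends on the
strictly past states. -/
def causalInput (f : K → (i : Fin n) → (Fin i.val → S) → X) (k : K) (s : Fin n → S) (i : Fin n) : X :=
  f k i fun j => s (Fin.castLE i.isLt.le j)

/-- The law of the input at a uniformly distributed time. -/
noncomputable def timeAveragedLaw (q : S → ℝ) (f : K → (i : Fin n) → (Fin i.val → S) → X) (x : X) :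
    ℝ :=
  (∑ i, ∑ k, ∑ s : Fin n → S, (∏ j, q (s j)) * if causalInput f k s i = x then 1 else 0) /
    (n * Fintype.card K)

variable {f : K → (i : Fin n) → (Fin i.val → S) → X}

omit [DecidableEq X] [Fintype S] [Fintype X] [Fintype K] in
-- Strict causality: the input at time `i` does not see the state at time `i`, which may therefore
-- be resampled.
theorem causalInput_update (k : K) (s : Fin n → S) (i : Fin n) (t : S) :
    causalInput f k (Function.update s i t) i = causalInput f k s i := by
  unfold causalInput
  congr 1
  ext j
  rw [Function.update_of_ne]
  exact fun h => (Fin.ext_iff.1 h ▸ j.isLt).false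

/-- Turns a sum of single-letter terms over times, messages and states into an expectation under one
input law; this makes the converse single-letter. -/
theorem sum_timeAveragedLaw_mul (hn : 0 < n) [Nonempty K] (Λ : X → ℝ) :
    n * Fintype.card K * ∑ x, timeAveragedLaw q f x * Λ x =
      ∑ i, ∑ k, ∑ s : Fin n → S, (∏ j, q (s j)) * Λ (causalInput f k s i) := by
  have h0 : (n * Fintype.card K : ℝ) ≠ 0 :=
    mul_ne_zero (by exact_mod_cast hn.ne') (by exact_mod_cast Fintype.card_ne_zero)
  rw [Finset.mul_sum]
  simp_rw [timeAveragedLaw, ← mul_assoc, mul_div_cancel₀ _ h0, Finset.sum_mul]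
  rw [Finset.sum_comm]
  refine Finset.sum_congr rfl fun i _ => ?_
  rw [Finset.sum_comm]
  refine Finset.sum_congr rfl fun k _ => ?_
  rw [Finset.sum_comm]
  refine Finset.sum_congr rfl fun s _ => ?_
  simp_rw [mul_assoc, ← Finset.mul_sum]
  simp

theorem timeAveragedLaw_mem_stdSimplex (hq : q ∈ stdSimplex ℝ S) (hn : 0 < n) [Nonempty K] :
    timeAveragedLaw q f ∈ stdSimplex ℝ X := by
  refine ⟨fun x => div_nonneg (Finset.sum_nonneg fun i _ => Finset.sum_nonneg fun k _ =>
    Finset.sum_nonneg fun s _ => mul_nonneg (Finset.prod_nonneg fun j _ => hq.1 _) ?_)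
      (by positivity), ?_⟩
  · split_ifs <;> norm_num
  · have h0 : (n * Fintype.card K : ℝ) ≠ 0 :=
      mul_ne_zero (by exact_mod_cast hn.ne') (by exact_mod_cast Fintype.card_ne_zero)
    have := sum_timeAveragedLaw_mul (q := q) (f := f) hn (fun _ => 1)
    simp only [mul_one, sum_prod_eq_one hq.2, Finset.sum_const, Finset.card_univ,
      Fintype.card_fin, nsmul_eq_mul] at this
    exact mul_left_cancel₀ h0 (by rw [this, mul_one])

omit [Fintype X] in
-- Every input that occurs with positive probability is charged by the averaged law, so the
-- reference density is positive wherever the true output density is.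
theorem timeAveragedLaw_pos (hq : q ∈ stdSimplex ℝ S) (k : K) (s : Fin n → S)
    (hs : ∀ j, 0 < q (s j)) (i : Fin n) : 0 < timeAveragedLaw q f (causalInput f k s i) := by
  have : Nonempty K := ⟨k⟩
  have hn : 0 < n := i.pos
  have hterm : ∀ i k (s : Fin n → S) x,
      0 ≤ (∏ j, q (s j)) * if causalInput f k s i = x then (1 : ℝ) else 0 := by
    intro i k s x
    refine mul_nonneg (Finset.prod_nonneg fun j _ => hq.1 _) ?_
    split_ifs <;> norm_num
  refine div_pos ?_ (mul_pos (by exact_mod_cast hn) (by exact_mod_cast Fintype.card_pos))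
  refine Finset.sum_pos' (fun i _ => Finset.sum_nonneg fun k _ => Finset.sum_nonneg fun s _ =>
    hterm _ _ _ _) ⟨i, Finset.mem_univ _, ?_⟩
  refine Finset.sum_pos' (fun k _ => Finset.sum_nonneg fun s _ => hterm _ _ _ _)
    ⟨k, Finset.mem_univ _, ?_⟩
  refine Finset.sum_pos' (fun s _ => hterm _ _ _ _) ⟨s, Finset.mem_univ _, ?_⟩
  rw [if_pos rfl, mul_one]
  exact Finset.prod_pos fun j _ => hs j

omit [Fintype X] [DecidableEq X] [IsFiniteMeasure m] in
theorem mul_le_avgDensity (hw : IsDensityFamily m w) (hq : q ∈ stdSimplex ℝ S) (x : X) (t : S)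
    (y : Y) : q t * w (x, t) y ≤ avgDensity q w x y :=
  Finset.single_le_sum (f := fun t => q t * w (x, t) y)
    (fun t _ => mul_nonneg (hq.1 t) (hw.nonneg _ _)) (Finset.mem_univ t)

omit [DecidableEq X] in
-- Since `q t * w (x, t) ≤ v x`, the integrand is dominated by the bounded `v |log (v / r)|` divided
-- by `q t`.
theorem integrable_mul_logRatio (hw : IsDensityFamily m w) (hq : q ∈ stdSimplex ℝ S) {c : X → Γ}
    {p : X → ℝ} (hp : p ∈ stdSimplex ℝ X) {x : X} (hx : 0 < p x) {t : S} (ht : 0 < q t) :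
    Integrable (fun y => w (x, t) y * Real.log (avgDensity q w x y /
      outputDensity (avgDensity q w) c p (c x) y)) m := by
  have hv := avgDensity_isDensityFamily hw hq
  refine integrable_of_abs_le ((hw.measurable _).mul (Real.measurable_log.comp
    ((hv.measurable x).div (measurable_outputDensity hv _)))) (C := (|Real.log (p x)| + 1) / q t)
    fun y => ?_
  rw [le_div_iff₀ ht]
  refine le_trans ?_ (abs_mul_log_div_le hx (hv.nonneg x y) (hv.le_one x y)
    (outputDensity_le_one hv hp (c x) y) (le_outputDensity hv hp hx y))
  rw [abs_mul, abs_mul, abs_of_nonneg (hw.nonneg _ _), abs_of_nonneg (hv.nonneg x y), mul_right_comm]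
  refine mul_le_mul_of_nonneg_right ?_ (abs_nonneg _)
  rw [mul_comm]
  exact mul_le_avgDensity hw hq x t y

omit [DecidableEq X] in
-- Only an inequality: for a value `γ` of zero mass the density is `0` by division by zero. The
-- converse needs no more.
theorem integral_outputDensity_le_one {v : X → Y → ℝ} (h : IsDensityFamily m v) (c : X → Γ)
    (p : X → ℝ) (γ : Γ) : ∫ y, outputDensity v c p γ y ∂m ≤ 1 := by
  simp only [outputDensity]
  rw [integral_div, integral_finsetSum _ fun x _ => (h.integrable x).const_mul _]
  simp only [integral_const_mul, h.integral_eq_one, mul_one]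
  exact div_self_le_one _

omit [DecidableEq X] [Fintype K] in
/-- The change of measure bound for one message. -/
theorem integral_sum_mul_le (hw : IsDensityFamily m w) (hq : q ∈ stdSimplex ℝ S) {c : X → Γ}
    {p : X → ℝ} (hp : p ∈ stdSimplex ℝ X) (k : K) (γ : Fin n → Γ)
    (hγ : ∀ s i, c (causalInput f k s i) = γ i)
    (hpos : ∀ s : Fin n → S, (∀ j, 0 < q (s j)) → ∀ i, 0 < p (causalInput f k s i))
    {g : (Fin n → Y) → ℝ} (hg : Measurable g) {C : ℝ} (hgC : ∀ y, |g y| ≤ C) :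
    ∫ y, (∑ s : Fin n → S, (∏ j, q (s j)) * ∏ j, w (causalInput f k s j, s j) (y j)) * g y
        ∂(Measure.pi fun _ => m) ≤
      (∑ i, ∑ s : Fin n → S, (∏ j, q (s j)) * ∫ y, avgDensity q w (causalInput f k s i) y *
        Real.log (avgDensity q w (causalInput f k s i) y /
          outputDensity (avgDensity q w) c p (c (causalInput f k s i)) y) ∂m) +
      ∫ y, Real.exp (g y) * ∏ i, outputDensity (avgDensity q w) c p (γ i) (y i)
        ∂(Measure.pi fun _ => m) - 1 := by
  have hv := avgDensity_isDensityFamily hw hq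
  set v := avgDensity q w with hvdef
  set ξ := causalInput f k with hξ
  set M := Measure.pi fun _ : Fin n => m with hM
  let r : Γ → Y → ℝ := outputDensity v c p
  have hr0 : ∀ γ y, 0 ≤ r γ y := outputDensity_nonneg hv hp
  have hr1 : ∀ γ y, r γ y ≤ 1 := outputDensity_le_one hv hp
  have hrm : ∀ γ, Measurable (r γ) := fun γ => measurable_outputDensity hv γ
  let L : X → Y → ℝ := fun x y => Real.log (v x y / r (c x) y)
  let D : (Fin n → S) → (Fin n → Y) → ℝ := fun s y => ∏ j, w (ξ s j, s j) (y j)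
  have hD0 : ∀ s y, 0 ≤ D s y := fun s y => Finset.prod_nonneg fun j _ => hw.nonneg _ _
  have hq0 : ∀ s : Fin n → S, 0 ≤ ∏ j, q (s j) := fun s => Finset.prod_nonneg fun j _ => hq.1 _
  have hDi : ∀ s, Integrable (D s) M := fun s => Integrable.fintype_prod fun j => hw.integrable _
  have hD1 : ∀ s, ∫ y, D s y ∂M = 1 := by
    intro s
    rw [hM, integral_fintype_prod_eq_prod (fun j => w (ξ s j, s j))]
    exact Finset.prod_eq_one fun j _ => hw.integral_eq_one _
  -- The pointwise inequality to be integrated: the tangent bound for each state sequence, then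
  -- summation over the sequences, where causality controls the exponential term.
  have hpt : ∀ y, (∑ s : Fin n → S, (∏ j, q (s j)) * D s y) * g y ≤
      (∑ i, ∑ s : Fin n → S, (∏ j, q (s j)) * (D s y * L (ξ s i) (y i))) +
        Real.exp (g y) * ∏ i, r (γ i) (y i) - ∑ s : Fin n → S, (∏ j, q (s j)) * D s y := by
    intro y
    -- Given the past, the sum over the present state of `q * w` is `v`, which cancels the
    -- denominator (or leaves `0 ≤ r` if `v = 0`). The bound is a product of numbers because `γ i`
    -- does not depend on the states.
    have hcausal : ∑ s : Fin n → S, ∏ i, (q (s i) * w (ξ s i, s i) (y i) *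
        (r (γ i) (y i) / v (ξ s i) (y i))) ≤ ∏ i, r (γ i) (y i) := by
      refine sum_prod_causal_le n (fun i u t => q t * w (f k i u, t) (y i) *
        (r (γ i) (y i) / v (f k i u) (y i))) _ ?_ (fun i => hr0 _ _) ?_
      · exact fun i u t => mul_nonneg (mul_nonneg (hq.1 t) (hw.nonneg _ _))
          (div_nonneg (hr0 _ _) (hv.nonneg _ _))
      · intro i u
        rw [← Finset.sum_mul]
        change v (f k i u) (y i) * _ ≤ _
        rcases (hv.nonneg (f k i u) (y i)).eq_or_lt with h0 | h0
        · rw [← h0, zero_mul]; exact hr0 _ _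
        · rw [mul_div_cancel₀ _ h0.ne']
    have hone : ∀ s : Fin n → S, (∏ j, q (s j)) * D s y * g y ≤
        (∑ i, (∏ j, q (s j)) * (D s y * L (ξ s i) (y i))) +
        Real.exp (g y) * (∏ i, (q (s i) * w (ξ s i, s i) (y i) *
          (r (γ i) (y i) / v (ξ s i) (y i)))) - (∏ j, q (s j)) * D s y := by
      intro s
      have hprod : ∏ i, (q (s i) * w (ξ s i, s i) (y i) * (r (γ i) (y i) / v (ξ s i) (y i))) =
          (∏ j, q (s j)) * D s y * ∏ i, (r (γ i) (y i) / v (ξ s i) (y i)) := by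
        rw [Finset.prod_mul_distrib, Finset.prod_mul_distrib]
      have hA : ∏ j, q (s j) * w (ξ s j, s j) (y j) = (∏ j, q (s j)) * D s y :=
        Finset.prod_mul_distrib
      rw [hprod]
      simp_rw [← mul_assoc (∏ j, q (s j))]
      rw [← Finset.mul_sum]
      rcases (mul_nonneg (hq0 s) (hD0 s y)).eq_or_lt with h0 | h0
      · rw [← h0]; simp
      · have hqw : ∀ j, 0 < q (s j) * w (ξ s j, s j) (y j) := by
          intro j
          refine (mul_nonneg (hq.1 _) (hw.nonneg _ _)).lt_of_ne' fun hz => h0.ne' ?_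
          rw [← hA]
          exact Finset.prod_eq_zero (Finset.mem_univ j) hz
        have hqs : ∀ j, 0 < q (s j) := fun j =>
          (hq.1 _).lt_of_ne' fun hz => (hqw j).ne' (by rw [hz, zero_mul])
        have hvpos : ∀ j, 0 < v (ξ s j) (y j) := fun j =>
          (hqw j).trans_le (mul_le_avgDensity hw hq _ _ _)
        have hrpos : ∀ j, 0 < r (γ j) (y j) := by
          intro j
          rw [← hγ s j]
          exact (mul_pos (hpos s hqs j) (hvpos j)).trans_le (le_outputDensity hv hp (hpos s hqs j) _)
        have hexp : Real.exp (-∑ i, L (ξ s i) (y i)) = ∏ i, (r (γ i) (y i) / v (ξ s i) (y i)) := by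
          rw [← Finset.sum_neg_distrib, Real.exp_sum]
          refine Finset.prod_congr rfl fun i _ => ?_
          change Real.exp (-Real.log (v (ξ s i) (y i) / r (c (ξ s i)) (y i))) = _
          rw [hγ s i, ← Real.log_inv, inv_div, Real.exp_log (div_pos (hrpos i) (hvpos i))]
        -- Multiplied by the positive weight of `(s, y)`, this is the claim: `exp (-∑ L)` is the
        -- product of the ratios `r / v`.
        have htan := Real.add_one_le_exp (g y - ∑ i, L (ξ s i) (y i))
        rw [sub_eq_add_neg (g y), Real.exp_add, hexp] at htan
        nlinarith
    calc _ = ∑ s : Fin n → S, (∏ j, q (s j)) * D s y * g y := Finset.sum_mul _ _ _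
      _ ≤ _ := Finset.sum_le_sum fun s _ => hone s
      _ = (∑ i, ∑ s : Fin n → S, (∏ j, q (s j)) * (D s y * L (ξ s i) (y i))) +
        Real.exp (g y) * (∑ s : Fin n → S, ∏ i, (q (s i) * w (ξ s i, s i) (y i) *
          (r (γ i) (y i) / v (ξ s i) (y i)))) - ∑ s : Fin n → S, (∏ j, q (s j)) * D s y := by
          rw [Finset.sum_sub_distrib, Finset.sum_add_distrib, Finset.sum_comm, Finset.mul_sum]
      _ ≤ _ := by gcongr
  have hDLi : ∀ i (s : Fin n → S), Integrable (fun y => (∏ j, q (s j)) * (D s y * L (ξ s i) (y i))) M ∧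
      ∫ y, (∏ j, q (s j)) * (D s y * L (ξ s i) (y i)) ∂M =
        (∏ j, q (s j)) * ∫ y, w (ξ s i, s i) y * L (ξ s i) y ∂m := by
    intro i s
    -- Attaching `L` to the `i`-th factor makes the integrand a product; every other factor
    -- integrates to `1`.
    let F : Fin n → Y → ℝ := fun j y => w (ξ s j, s j) y * if j = i then L (ξ s i) y else 1
    have hF : ∀ y : Fin n → Y, D s y * L (ξ s i) (y i) = ∏ j, F j (y j) := by
      intro y
      simp only [F, Finset.prod_mul_distrib]
      rw [Finset.prod_ite_eq' Finset.univ i fun j => L (ξ s i) (y j)]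
      simp [D]
    simp_rw [hF]
    constructor
    · rcases (hq0 s).eq_or_lt with h0 | h0
      · simp [← h0]
      · have hqs : ∀ j, 0 < q (s j) := fun j => (hq.1 _).lt_of_ne' fun hz =>
          h0.ne' (Finset.prod_eq_zero (Finset.mem_univ j) hz)
        refine (Integrable.fintype_prod fun j => ?_).const_mul _
        by_cases hj : j = i
        · subst hj
          simpa only [F, if_true] using
            integrable_mul_logRatio hw hq (c := c) hp (hpos s hqs j) (hqs j)
        · simpa [F, hj] using hw.integrable _
    · rw [integral_const_mul, hM, integral_fintype_prod_eq_prod F]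
      congr 1
      rw [Finset.prod_eq_single i]
      · simp [F]
      · intro j _ hj
        simpa [F, hj] using hw.integral_eq_one _
      · simp
  have hsumi : Integrable (fun y => ∑ i, ∑ s : Fin n → S, (∏ j, q (s j)) *
      (D s y * L (ξ s i) (y i))) M :=
    integrable_finsetSum _ fun i _ => integrable_finsetSum _ fun s _ => (hDLi i s).1
  have hPi : Integrable (fun y => ∑ s : Fin n → S, (∏ j, q (s j)) * D s y) M :=
    integrable_finsetSum _ fun s _ => (hDi s).const_mul _
  have hexpi : Integrable (fun y => Real.exp (g y) * ∏ i, r (γ i) (y i)) M := by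
    refine integrable_of_abs_le (hg.exp.mul (Finset.measurable_prod _ fun i _ =>
      (hrm _).comp (measurable_pi_apply i))) (C := Real.exp C) fun y => ?_
    rw [abs_mul, Real.abs_exp, abs_of_nonneg (Finset.prod_nonneg fun i _ => hr0 _ _)]
    exact (mul_le_of_le_one_right (Real.exp_pos _).le (Finset.prod_le_one (fun i _ => hr0 _ _)
      fun i _ => hr1 _ _)).trans (Real.exp_le_exp.2 (le_of_abs_le (hgC y)))
  have hPgi : Integrable (fun y => (∑ s : Fin n → S, (∏ j, q (s j)) * D s y) * g y) M :=
    hPi.mul_bdd hg.aestronglyMeasurable (Filter.Eventually.of_forall hgC)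
  refine (integral_mono hPgi ((hsumi.add hexpi).sub hPi) hpt).trans_eq ?_
  rw [integral_sub' (hsumi.add hexpi) hPi, integral_add' hsumi hexpi]
  congr 1
  · congr 1
    rw [integral_finsetSum _ fun i _ => integrable_finsetSum _ fun s _ => (hDLi i s).1]
    refine Finset.sum_congr rfl fun i _ => ?_
    rw [integral_finsetSum _ fun s _ => (hDLi i s).1]
    simp_rw [(hDLi i _).2]
    -- The input at time `i` is unaffected by resampling `s_i`, so the average over a fresh state
    -- turns `w` into `v`.
    rw [sum_prod_resample hq.2 i (fun s t => ∫ y, w (ξ s i, t) y * L (ξ s i) y ∂m)]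
    · refine Finset.sum_congr rfl fun s _ => ?_
      rcases (hq0 s).eq_or_lt with h0 | h0
      · rw [← h0, zero_mul, zero_mul]
      · have hqs : ∀ j, 0 < q (s j) := fun j => (hq.1 _).lt_of_ne' fun hz =>
          h0.ne' (Finset.prod_eq_zero (Finset.mem_univ j) hz)
        congr 1
        simp_rw [← integral_const_mul]
        rw [← integral_finsetSum]
        · refine integral_congr_ae (Filter.Eventually.of_forall fun y => ?_)
          simp only [hvdef, avgDensity, Finset.sum_mul, mul_assoc]
          rfl
        · intro t _
          rcases (hq.1 t).eq_or_lt with ht | ht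
          · simp [← ht]
          · exact (integrable_mul_logRatio hw hq (c := c) hp (hpos s hqs i) ht).const_mul _
    · intro s t u
      simp only [hξ, causalInput_update]
  · rw [integral_finsetSum _ fun s _ => (hDi s).const_mul _]
    simp_rw [integral_const_mul, hD1, mul_one]
    exact sum_prod_eq_one hq.2

end Converse

section Converse

variable {S X Γ Y K : Type*} [Fintype S] [Fintype X] [DecidableEq X] [DecidableEq Γ]
  [MeasurableSpace Y] [Fintype K]
  {m : Measure Y} [IsFiniteMeasure m] {q : S → ℝ} {w : X × S → Y → ℝ} {n : ℕ}
  {f : K → (i : Fin n) → (Fin i.val → S) → X}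

/-- The density of the output sequence for the message `k`. -/
noncomputable def causalOutputDensity (q : S → ℝ) (w : X × S → Y → ℝ)
    (f : K → (i : Fin n) → (Fin i.val → S) → X) (k : K) (y : Fin n → Y) : ℝ :=
  ∑ s : Fin n → S, (∏ j, q (s j)) * ∏ j, w (causalInput f k s j, s j) (y j)

omit [Fintype X] [DecidableEq X] [Fintype K] in
theorem integrable_causalOutputDensity (hw : IsDensityFamily m w) (k : K) :
    Integrable (causalOutputDensity q w f k) (Measure.pi fun _ => m) :=
  integrable_finsetSum _ fun _ _ => (Integrable.fintype_prod fun _ => hw.integrable _).const_mul _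

omit [Fintype X] [DecidableEq X] [Fintype K] in
theorem integral_causalOutputDensity (hw : IsDensityFamily m w) (hq : q ∈ stdSimplex ℝ S) (k : K) :
    ∫ y, causalOutputDensity q w f k y ∂(Measure.pi fun _ => m) = 1 := by
  unfold causalOutputDensity
  rw [integral_finsetSum _ fun _ _ => (Integrable.fintype_prod fun _ => hw.integrable _).const_mul _]
  rw [← sum_prod_eq_one (ι := Fin n) hq.2]
  refine Finset.sum_congr rfl fun s _ => ?_
  rw [integral_const_mul, integral_fintype_prod_eq_prod (fun j => w (causalInput f k s j, s j)),
    Finset.prod_eq_one fun j _ => hw.integral_eq_one _, mul_one]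

omit [Fintype X] [DecidableEq X] [Fintype K] in
theorem toReal_lintegral_pi [MeasurableSpace S] [MeasurableSingletonClass S]
    [MeasurableSpace X] (hw : IsDensityFamily m w)
    {Q : Measure S} [IsProbabilityMeasure Q] {W : Kernel (X × S) Y}
    (hW : ∀ z, W z = m.withDensity fun y => ENNReal.ofReal (w z y)) (k : K)
    {E : Set (Fin n → Y)} (hE : MeasurableSet E) :
    (∫⁻ s, Measure.pi (fun i => W (causalInput f k s i, s i)) E ∂(Measure.pi fun _ => Q)).toReal =
      ∫ y in E, causalOutputDensity (fun s => Q.real {s}) w f k y ∂(Measure.pi fun _ => m) := by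
  have hprob := hw.isProbabilityMeasure
  have hfam : ∀ s : Fin n → S, IsDensityFamily m fun i => w (causalInput f k s i, s i) :=
    fun s => hw.comp fun i => (causalInput f k s i, s i)
  simp_rw [hW]
  rw [lintegral_fintype, ENNReal.toReal_sum fun s _ =>
    ENNReal.mul_ne_top (measure_ne_top _ _) (measure_ne_top _ _)]
  unfold causalOutputDensity
  rw [integral_finsetSum _ fun s _ =>
    ((Integrable.fintype_prod fun _ => hw.integrable _).const_mul _).integrableOn]
  refine Finset.sum_congr rfl fun s _ => ?_
  rw [ENNReal.toReal_mul, ← measureReal_def, measureReal_pi_withDensity (hfam s) hE,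
    Measure.pi_singleton, ENNReal.toReal_prod, integral_const_mul, mul_comm]
  rfl

omit [DecidableEq X] in
theorem integrable_prod_outputDensity {v : X → Y → ℝ} (hv : IsDensityFamily m v) {p : X → ℝ}
    (hp : p ∈ stdSimplex ℝ X) (c : X → Γ) (γ : Fin n → Γ) :
    Integrable (fun y : Fin n → Y => ∏ i, outputDensity v c p (γ i) (y i))
      (Measure.pi fun _ => m) :=
  Integrable.fintype_prod fun _ => integrable_of_abs_le (measurable_outputDensity hv _) (C := 1)
    fun y => by
      rw [abs_of_nonneg (outputDensity_nonneg hv hp _ _)]; exact outputDensity_le_one hv hp _ _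

omit [DecidableEq X] in
theorem integral_prod_outputDensity_le_one {v : X → Y → ℝ} (hv : IsDensityFamily m v) {p : X → ℝ}
    (hp : p ∈ stdSimplex ℝ X) (c : X → Γ) (γ : Fin n → Γ) :
    ∫ y : Fin n → Y, ∏ i, outputDensity v c p (γ i) (y i) ∂(Measure.pi fun _ => m) ≤ 1 := by
  rw [integral_fintype_prod_eq_prod (fun i => outputDensity v c p (γ i))]
  exact Finset.prod_le_one (fun i _ => integral_nonneg (outputDensity_nonneg hv hp _))
    fun i _ => integral_outputDensity_le_one hv c p _

/-- A quantified Fano inequality. `H k` is the event that the tested part of the message `k` is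
decoded correctly, and `M` the number of its values: under the reference law the average probability
of `H k` is at most `1 / M`, under the true law it is at least `1 - ε`. The change of measure bound,
averaged over `k`, compares the two. -/
theorem converse_bound (hw : IsDensityFamily m w) (hq : q ∈ stdSimplex ℝ S) (hn : 0 < n)
    [Nonempty K] {c : X → Γ} (γ : K → Fin n → Γ) (hγ : ∀ k s i, c (causalInput f k s i) = γ k i)
    {H : K → Set (Fin n → Y)} (hH : ∀ k, MeasurableSet (H k)) {M ε : ℝ} (hM : 1 ≤ M)
    (hε0 : 0 < ε) (hε1 : ε < 1)
    (herr : ∑ k, ∫ y in (H k)ᶜ, causalOutputDensity q w f k y ∂(Measure.pi fun _ => m) ≤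
      ε * Fintype.card K)
    (hR : M * ∑ k, ∫ y in H k, ∏ i, outputDensity (avgDensity q w) c (timeAveragedLaw q f) (γ k i)
      (y i) ∂(Measure.pi fun _ => m) ≤ Fintype.card K) :
    (1 - ε) * Real.log M + Real.log (1 - ε) + ε * Real.log ε ≤
      n * condInfo m (avgDensity q w) c (timeAveragedLaw q f) := by
  classical
  have hv := avgDensity_isDensityFamily hw hq
  have hp : timeAveragedLaw q f ∈ stdSimplex ℝ X := timeAveragedLaw_mem_stdSimplex hq hn
  have hcard : (0 : ℝ) < Fintype.card K := by exact_mod_cast Fintype.card_pos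
  set v := avgDensity q w with hvdef
  set p := timeAveragedLaw q f with hpdef
  let r : K → (Fin n → Y) → ℝ := fun k y => ∏ i, outputDensity v c p (γ k i) (y i)
  have hr0 : ∀ k y, 0 ≤ r k y := fun k y =>
    Finset.prod_nonneg fun i _ => outputDensity_nonneg hv hp _ _
  have hri : ∀ k, Integrable (r k) (Measure.pi fun _ => m) := fun k =>
    integrable_prod_outputDensity hv hp c (γ k)
  have hr1 : ∀ k, ∫ y, r k y ∂(Measure.pi fun _ => m) ≤ 1 := fun k =>
    integral_prod_outputDensity_le_one hv hp c (γ k)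
  -- The test function equals `α` on `H k` and `β` off it. Under the reference law the average of
  -- its exponential is then at most `(1 - ε) + ε = 1`, which cancels the `-1` of the change of
  -- measure bound.
  let α := Real.log ((1 - ε) * M)
  let β := Real.log ε
  let P : K → (Fin n → Y) → ℝ := causalOutputDensity q w f
  have hPi : ∀ k, Integrable (P k) (Measure.pi fun _ => m) := integrable_causalOutputDensity hw
  have hPtot : ∀ k, ∫ y in H k, P k y ∂(Measure.pi fun _ => m) =
      1 - ∫ y in (H k)ᶜ, P k y ∂(Measure.pi fun _ => m) := fun k => by
    rw [← integral_causalOutputDensity (f := f) hw hq k, ← integral_add_compl (hH k) (hPi k)]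
    simp [P]
  let g : K → (Fin n → Y) → ℝ := fun k => (H k).piecewise (fun _ => α) fun _ => β
  have hone : ∀ k, α * (1 - ∫ y in (H k)ᶜ, P k y ∂(Measure.pi fun _ => m)) +
      β * ∫ y in (H k)ᶜ, P k y ∂(Measure.pi fun _ => m) ≤
      (∑ i, ∑ s : Fin n → S, (∏ j, q (s j)) * ∫ y, v (causalInput f k s i) y *
        Real.log (v (causalInput f k s i) y / outputDensity v c p (c (causalInput f k s i)) y) ∂m) +
      ((1 - ε) * M * ∫ y in H k, r k y ∂(Measure.pi fun _ => m)) + ε - 1 := by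
    intro k
    have hg : Measurable (g k) := measurable_const.piecewise (hH k) measurable_const
    have hgC : ∀ y, |g k y| ≤ max |α| |β| := by
      intro y
      by_cases hy : y ∈ H k
      · simp [g, hy]
      · simp [g, hy]
    have hmain := integral_sum_mul_le hw hq hp k (γ k) (hγ k)
      (fun s hs i => timeAveragedLaw_pos hq k s hs i) hg hgC
    have hleft : ∫ y, P k y * g k y ∂(Measure.pi fun _ => m) =
        α * (1 - ∫ y in (H k)ᶜ, P k y ∂(Measure.pi fun _ => m)) +
        β * ∫ y in (H k)ᶜ, P k y ∂(Measure.pi fun _ => m) := by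
      rw [← integral_add_compl (hH k)
        ((hPi k).mul_bdd hg.aestronglyMeasurable (Filter.Eventually.of_forall hgC)),
        setIntegral_congr_fun (g := fun y => P k y * α) (hH k) fun y hy => by simp [g, hy],
        setIntegral_congr_fun (g := fun y => P k y * β) (hH k).compl
          fun y hy => by simp [g, show y ∉ H k from hy],
        integral_mul_const, integral_mul_const, hPtot, mul_comm, mul_comm β]
    have hright : ∫ y, Real.exp (g k y) * r k y ∂(Measure.pi fun _ => m) ≤
        (1 - ε) * M * ∫ y in H k, r k y ∂(Measure.pi fun _ => m) + ε := by
      have hα : Real.exp α = (1 - ε) * M := Real.exp_log (mul_pos (by linarith) (by linarith))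
      have hexpi : Integrable (fun y => Real.exp (g k y) * r k y) (Measure.pi fun _ => m) := by
        refine (hri k).bdd_mul (c := Real.exp (max |α| |β|)) hg.exp.aestronglyMeasurable
          (Filter.Eventually.of_forall fun y => ?_)
        rw [Real.norm_eq_abs, Real.abs_exp]
        exact Real.exp_le_exp.2 (le_of_abs_le (hgC y))
      rw [← integral_add_compl (hH k) hexpi,
        setIntegral_congr_fun (g := fun y => ((1 - ε) * M) * r k y) (hH k)
          fun y hy => by simp [g, hy, hα],
        setIntegral_congr_fun (g := fun y => ε * r k y) (hH k).compl
          fun y hy => by simp [g, show y ∉ H k from hy, β, Real.exp_log hε0],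
        integral_const_mul, integral_const_mul]
      have h1 : ∫ y in (H k)ᶜ, r k y ∂(Measure.pi fun _ => m) ≤ 1 :=
        (setIntegral_le_integral (hri k) (Filter.Eventually.of_forall (hr0 k))).trans (hr1 k)
      nlinarith
    have h2 : ∫ y, P k y * g k y ∂(Measure.pi fun _ => m) ≤ _ := hmain
    rw [hleft] at h2
    linarith
  have hsum := Finset.sum_le_sum fun k (_ : k ∈ Finset.univ) => hone k
  set e := ∑ k, ∫ y in (H k)ᶜ, P k y ∂(Measure.pi fun _ => m) with he
  have he0 : 0 ≤ e := Finset.sum_nonneg fun k _ => integral_nonneg fun y =>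
    Finset.sum_nonneg fun s _ => mul_nonneg (Finset.prod_nonneg fun j _ => hq.1 _)
      (Finset.prod_nonneg fun j _ => hw.nonneg _ _)
  have hlhs : ∑ k, (α * (1 - ∫ y in (H k)ᶜ, P k y ∂(Measure.pi fun _ => m)) +
      β * ∫ y in (H k)ᶜ, P k y ∂(Measure.pi fun _ => m)) = α * (Fintype.card K - e) + β * e := by
    rw [Finset.sum_add_distrib, ← Finset.mul_sum, ← Finset.mul_sum, Finset.sum_sub_distrib]
    simp [he]
  have hinfo := sum_timeAveragedLaw_mul (q := q) (f := f) hn fun x =>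
    ∫ y, v x y * Real.log (v x y / outputDensity v c p (c x) y) ∂m
  rw [hlhs, Finset.sum_sub_distrib, Finset.sum_add_distrib, Finset.sum_add_distrib, Finset.sum_comm,
    ← hinfo, ← Finset.mul_sum] at hsum
  simp only [Finset.sum_const, Finset.card_univ, nsmul_eq_mul, mul_one] at hsum
  change _ ≤ n * Fintype.card K * condInfo m v c p + _ + _ - _ at hsum
  have hRR : (1 - ε) * M * ∑ k, ∫ y in H k, r k y ∂(Measure.pi fun _ => m) ≤
      (1 - ε) * Fintype.card K := by
    rw [mul_assoc]; exact mul_le_mul_of_nonneg_left hR (by linarith)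
  have hα : α = Real.log (1 - ε) + Real.log M :=
    Real.log_mul (by linarith) (by linarith)
  have hlogM := Real.log_nonneg hM
  have hlog1 : Real.log (1 - ε) ≤ 0 := Real.log_nonpos (by linarith) (by linarith)
  have hβ : β ≤ 0 := Real.log_nonpos hε0.le hε1.le
  have hfin : Fintype.card K * ((1 - ε) * Real.log M + Real.log (1 - ε) + ε * Real.log ε) ≤
      Fintype.card K * (n * condInfo m v c p) := by
    have h1 : α * (Fintype.card K - e) + β * e ≤ n * Fintype.card K * condInfo m v c p := by linarith
    rw [hα] at h1
    -- The total error `e` is only known to be at most `ε` times the number of messages. The signs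
    -- of `log M`, `β` and `log (1 - ε)` all allow it to be replaced in the required direction.
    have h2 : Real.log M * e ≤ Real.log M * (ε * Fintype.card K) :=
      mul_le_mul_of_nonneg_left herr hlogM
    have h3 : β * (ε * Fintype.card K) ≤ β * e := mul_le_mul_of_nonpos_left herr hβ
    have h4 : Real.log (1 - ε) * e ≤ 0 := mul_nonpos_of_nonpos_of_nonneg hlog1 he0
    have h5 : β = Real.log ε := rfl
    rw [h5] at h1 h3
    nlinarith
  exact le_of_mul_le_mul_left hfin hcard

end Converse

theorem sum_setIntegral_fiber {Z A : Type*} [MeasurableSpace Z] {μ : Measure Z} [Fintype A]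
    {F : Z → ℝ} (hF : Integrable F μ) {g : Z → A} (hg : ∀ a, MeasurableSet {z | g z = a}) :
    ∑ a, ∫ z in {z | g z = a}, F z ∂μ = ∫ z, F z ∂μ := by
  classical
  simp_rw [← integral_indicator (hg _)]
  rw [← integral_finsetSum _ fun a _ => hF.indicator (hg a)]
  congr 1
  ext z
  rw [Finset.sum_eq_single (g z)]
  · exact Set.indicator_of_mem (s := {z' | g z' = g z}) rfl F
  · exact fun a _ ha => Set.indicator_of_notMem (s := {z' | g z' = a}) (fun h => ha (Eq.symm h)) F
  · simp

theorem exists_measure_real_singleton {A : Type*} [Fintype A] [MeasurableSpace A]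
    [MeasurableSingletonClass A] {p : A → ℝ} (hp : p ∈ stdSimplex ℝ A) :
    ∃ P : Measure A, IsProbabilityMeasure P ∧ (fun a => P.real {a}) = p := by
  classical
  have hs : ∀ a, (∑ x, ENNReal.ofReal (p x) • Measure.dirac x : Measure A) {a} =
      ENNReal.ofReal (p a) := by
    intro a
    rw [Measure.finsetSum_apply, Finset.sum_eq_single a]
    · simp
    · intro b _ hb
      simp [hb]
    · simp
  refine ⟨∑ x, ENNReal.ofReal (p x) • Measure.dirac x, ⟨?_⟩, ?_⟩
  · rw [Measure.finsetSum_apply]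
    simp only [Measure.smul_apply, measure_univ, smul_eq_mul, mul_one]
    rw [← ENNReal.ofReal_sum_of_nonneg fun a _ => hp.1 a, hp.2, ENNReal.ofReal_one]
  · ext a
    rw [measureReal_def, hs, ENNReal.toReal_ofReal (hp.1 a)]

/-! ### Converse for codes and passage to the limit -/

section Converse

variable {S X₁ X₂ Y : Type*}
    [Fintype S] [MeasurableSpace S] [MeasurableSingletonClass S]
    [Fintype X₁] [MeasurableSpace X₁]
    [Fintype X₂] [MeasurableSpace X₂]
    [MeasurableSpace Y]
    {Q : Measure S} [IsProbabilityMeasure Q]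
    {W : Kernel ((X₁ × X₂) × S) Y}
    {m : Measure Y} [IsFiniteMeasure m] {w : (X₁ × X₂) × S → Y → ℝ}

omit [Fintype X₁] [Fintype X₂] in
theorem InformedCode.sum_setIntegral_le {Mc M₁ n : ℕ} (hMc : 0 < Mc) (hM₁ : 0 < M₁)
    (hw : IsDensityFamily m w) (hW : ∀ z, W z = m.withDensity fun y => ENNReal.ofReal (w z y))
    (C : InformedCode S X₁ X₂ Y Mc M₁ n) {ε : ℝ} (hε : 0 ≤ ε)
    (herr : C.error Q W ≤ ENNReal.ofReal ε) :
    ∑ k : Fin Mc × Fin M₁, ∫ y in {y | C.dec y ≠ k}, causalOutputDensity (fun s => Q.real {s}) w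
      (fun k i u => (C.enc₁ i k.1 k.2 u, C.enc₂ i k.1)) k y ∂(Measure.pi fun _ => m) ≤
      ε * Fintype.card (Fin Mc × Fin M₁) := by
  have hprob := hw.isProbabilityMeasure
  let f : Fin Mc × Fin M₁ → (i : Fin n) → (Fin i.val → S) → X₁ × X₂ :=
    fun k i u => (C.enc₁ i k.1 k.2 u, C.enc₂ i k.1)
  have hdec : ∀ k, MeasurableSet {y | C.dec y ≠ k} := fun k =>
    (C.measurable_dec (MeasurableSet.singleton k)).compl
  let t : Fin Mc × Fin M₁ → ℝ≥0∞ := fun k =>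
    ∫⁻ s, Measure.pi (fun i => W (causalInput f k s i, s i)) {y | C.dec y ≠ k}
      ∂(Measure.pi fun _ : Fin n => Q)
  have ht : ∀ k, t k ≠ ∞ := by
    intro k
    refine ne_top_of_le_ne_top ENNReal.one_ne_top ?_
    calc t k ≤ ∫⁻ _, 1 ∂(Measure.pi fun _ : Fin n => Q) := by
          refine lintegral_mono fun s => ?_
          simp only [hW]
          exact prob_le_one
      _ = 1 := by simp
  have herr' : (∑ k, t k) / ((Mc : ℝ≥0∞) * M₁) ≤ ENNReal.ofReal ε := by
    rw [Fintype.sum_prod_type]; exact herr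
  have hcard : ((Mc : ℝ≥0∞) * M₁) ≠ 0 := by
    simp [hMc.ne', hM₁.ne']
  have hcard' : ((Mc : ℝ≥0∞) * M₁) ≠ ∞ := ENNReal.mul_ne_top (by simp) (by simp)
  rw [ENNReal.div_le_iff hcard hcard'] at herr'
  have := ENNReal.toReal_mono (ENNReal.mul_ne_top ENNReal.ofReal_ne_top hcard') herr'
  rw [ENNReal.toReal_sum fun k _ => ht k, ENNReal.toReal_mul, ENNReal.toReal_ofReal hε] at this
  simp only [t, fun k => toReal_lintegral_pi (f := f) hw (Q := Q) hW k (hdec k)] at this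
  refine this.trans_eq ?_
  simp

theorem InformedCode.exists_bounds [DecidableEq X₁] [DecidableEq X₂] {Mc M₁ n : ℕ} (hn : 0 < n)
    (hMc : 0 < Mc) (hM₁ : 0 < M₁) (hw : IsDensityFamily m w)
    (hW : ∀ z, W z = m.withDensity fun y => ENNReal.ofReal (w z y))
    (C : InformedCode S X₁ X₂ Y Mc M₁ n) {ε : ℝ} (hε0 : 0 < ε) (hε1 : ε < 1)
    (herr : C.error Q W ≤ ENNReal.ofReal ε) :
    ∃ p ∈ stdSimplex ℝ (X₁ × X₂),
      (1 - ε) * Real.log M₁ + Real.log (1 - ε) + ε * Real.log ε ≤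
        n * condInfo m (avgDensity (fun s => Q.real {s}) w) Prod.snd p ∧
      (1 - ε) * Real.log (Mc * M₁) + Real.log (1 - ε) + ε * Real.log ε ≤
        n * condInfo m (avgDensity (fun s => Q.real {s}) w) (fun _ => ()) p := by
  have hq := real_singleton_mem_stdSimplex Q
  have hv := avgDensity_isDensityFamily hw hq
  let f : Fin Mc × Fin M₁ → (i : Fin n) → (Fin i.val → S) → X₁ × X₂ :=
    fun k i u => (C.enc₁ i k.1 k.2 u, C.enc₂ i k.1)
  have hne : Nonempty (Fin Mc × Fin M₁) := ⟨(⟨0, hMc⟩, ⟨0, hM₁⟩)⟩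
  have hsum := C.sum_setIntegral_le hMc hM₁ hw hW hε0.le herr
  have hp := timeAveragedLaw_mem_stdSimplex (f := f) hq hn
  have hM₁' : (1 : ℝ) ≤ M₁ := by exact_mod_cast hM₁
  have hMc' : (1 : ℝ) ≤ Mc := by exact_mod_cast hMc
  refine ⟨timeAveragedLaw (fun s => Q.real {s}) f, hp, ?_, ?_⟩
  -- Bound on the individual rate: the reference law depends on the common message only. For each
  -- common message the events for the `M₁` individual messages are a partition, so their total
  -- reference mass is at most `1`.
  · have hm : ∀ a, MeasurableSet {y | (C.dec y).2 = a} := fun a =>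
      (measurable_snd.comp C.measurable_dec) (MeasurableSet.singleton a)
    refine converse_bound hw hq hn (fun k i => C.enc₂ i k.1) (fun _ _ _ => rfl)
      (H := fun k => {y | (C.dec y).2 = k.2}) (fun k => hm k.2) hM₁' hε0 hε1 ?_ ?_
    · refine le_trans (Finset.sum_le_sum fun k _ => ?_) hsum
      refine setIntegral_mono_set (integrable_causalOutputDensity hw k).integrableOn ?_ ?_
      · exact Filter.Eventually.of_forall fun y => Finset.sum_nonneg fun s _ =>
          mul_nonneg (Finset.prod_nonneg fun j _ => hq.1 _)
            (Finset.prod_nonneg fun j _ => hw.nonneg _ _)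
      · exact Filter.Eventually.of_forall fun y hy hk => hy (congrArg Prod.snd hk)
    · rw [Fintype.sum_prod_type]
      simp_rw [sum_setIntegral_fiber (integrable_prod_outputDensity hv hp Prod.snd _) hm]
      simp only [Fintype.card_prod, Fintype.card_fin, Nat.cast_mul]
      rw [mul_comm]
      refine mul_le_mul_of_nonneg_right ?_ (by positivity)
      calc _ ≤ ∑ _ : Fin Mc, (1 : ℝ) := Finset.sum_le_sum fun k _ => integral_prod_outputDensity_le_one hv hp Prod.snd _
        _ = Mc := by simp
  -- Bound on the sum rate: one reference law serves all messages, and the decoding sets partition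
  -- the outputs.
  · have hm : ∀ a, MeasurableSet {y | C.dec y = a} := fun a =>
      C.measurable_dec (MeasurableSet.singleton a)
    refine converse_bound hw hq hn (fun _ _ => ()) (fun _ _ _ => rfl)
      (H := fun k => {y | C.dec y = k}) hm (by nlinarith) hε0 hε1 hsum ?_
    rw [sum_setIntegral_fiber (integrable_prod_outputDensity hv hp (fun _ => ()) fun _ => ()) hm]
    simp only [Fintype.card_prod, Fintype.card_fin, Nat.cast_mul]
    exact mul_le_of_le_one_right (by positivity) (integral_prod_outputDensity_le_one hv hp (fun _ => ()) fun _ => ())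

theorem InformedAchievable.exists_bounds [DecidableEq X₁] [DecidableEq X₂]
    (hw : IsDensityFamily m w)
    (hW : ∀ z, W z = m.withDensity fun y => ENNReal.ofReal (w z y)) {R : ℝ × ℝ}
    (hR : InformedAchievable Q W R) {ε : ℝ} (hε0 : 0 < ε) (hε1 : ε < 1) :
    0 ≤ R.1 ∧ 0 ≤ R.2 ∧ ∃ p ∈ stdSimplex ℝ (X₁ × X₂),
      (1 - ε) * (R.2 * Real.log 2) + Real.log (1 - ε) + ε * Real.log ε ≤
        condInfo m (avgDensity (fun s => Q.real {s}) w) Prod.snd p ∧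
      (1 - ε) * ((R.1 + R.2) * Real.log 2) + Real.log (1 - ε) + ε * Real.log ε ≤
        condInfo m (avgDensity (fun s => Q.real {s}) w) (fun _ => ()) p := by
  obtain ⟨n, Mc, M₁, hn, hMc, hM₁, hc, h1, C, herr⟩ := hR ε hε0
  have hn' : (1 : ℝ) ≤ n := by exact_mod_cast hn
  have hlog2 := Real.log_pos one_lt_two
  have hMc' : (1 : ℝ) ≤ Mc := by exact_mod_cast hMc
  have hM₁' : (1 : ℝ) ≤ M₁ := by exact_mod_cast hM₁
  have hlc : Real.log Mc = n * (R.1 * Real.log 2) := by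
    rw [hc, Real.log_rpow two_pos, mul_assoc]
  have hl1 : Real.log M₁ = n * (R.2 * Real.log 2) := by
    rw [h1, Real.log_rpow two_pos, mul_assoc]
  have hnn : ∀ r : ℝ, 0 ≤ n * (r * Real.log 2) → 0 ≤ r := fun r h =>
    nonneg_of_mul_nonneg_left (nonneg_of_mul_nonneg_right h (by linarith)) hlog2
  obtain ⟨p, hp, hb1, hb2⟩ := C.exists_bounds hn hMc hM₁ hw hW hε0 hε1 herr
  have hδ : Real.log (1 - ε) + ε * Real.log ε ≤ 0 := add_nonpos
    (Real.log_nonpos (by linarith) (by linarith))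
    (mul_nonpos_of_nonneg_of_nonpos hε0.le (Real.log_nonpos hε0.le hε1.le))
  -- The correction is nonpositive and `n ≥ 1`, so dividing by `n` only helps: no large block length
  -- is needed.
  have hδn : n * (Real.log (1 - ε) + ε * Real.log ε) ≤ Real.log (1 - ε) + ε * Real.log ε := by
    nlinarith
  refine ⟨hnn _ (hlc ▸ Real.log_nonneg hMc'), hnn _ (hl1 ▸ Real.log_nonneg hM₁'), p, hp, ?_, ?_⟩
  · rw [hl1] at hb1
    refine le_of_mul_le_mul_left ?_ (show (0 : ℝ) < n by linarith)
    linarith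
  · rw [Real.log_mul (by linarith) (by linarith), hlc, hl1] at hb2
    refine le_of_mul_le_mul_left ?_ (show (0 : ℝ) < n by linarith)
    linarith

/-- Approximate `R` by achievable pairs, applying the bounds to the `j`-th pair with error `1 / (j +
2)`. The input laws have a convergent subsequence in the compact simplex, and both inequalities pass
to the limit by continuity of `condInfo`. -/
theorem exists_bounds_of_mem_informedCapacityRegion [DecidableEq X₁] [DecidableEq X₂]
    (hw : IsDensityFamily m w)
    (hW : ∀ z, W z = m.withDensity fun y => ENNReal.ofReal (w z y)) {R : ℝ × ℝ}
    (hR : R ∈ informedCapacityRegion Q W) :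
    0 ≤ R.1 ∧ 0 ≤ R.2 ∧ ∃ p ∈ stdSimplex ℝ (X₁ × X₂),
      R.2 * Real.log 2 ≤ condInfo m (avgDensity (fun s => Q.real {s}) w) Prod.snd p ∧
      (R.1 + R.2) * Real.log 2 ≤
        condInfo m (avgDensity (fun s => Q.real {s}) w) (fun _ => ()) p := by
  have hv := avgDensity_isDensityFamily hw (real_singleton_mem_stdSimplex Q)
  obtain ⟨u, hu, hlim⟩ := mem_closure_iff_seq_limit.1 hR
  have hlim1 := (continuous_fst.tendsto R).comp hlim
  have hlim2 := (continuous_snd.tendsto R).comp hlim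
  let ε : ℕ → ℝ := fun j => 1 / ((j : ℝ) + 1 + 1)
  have hε0 : ∀ j, 0 < ε j := fun j => by positivity
  have hε1 : ∀ j, ε j < 1 := fun j => by
    rw [div_lt_one (by positivity)]
    have : (0 : ℝ) ≤ j := Nat.cast_nonneg j
    linarith
  have hεlim : Filter.Tendsto ε Filter.atTop (nhds 0) := by
    have := (tendsto_one_div_add_atTop_nhds_zero_nat (𝕜 := ℝ)).comp (Filter.tendsto_add_atTop_nat 1)
    refine this.congr fun j => ?_
    simp [ε]
  choose h1 h2 p hp hb1 hb2 using fun j =>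
    InformedAchievable.exists_bounds hw hW (hu j) (hε0 j) (hε1 j)
  obtain ⟨p₀, hp₀, φ, hφ, hpφ⟩ := (isCompact_stdSimplex ℝ (X₁ × X₂)).tendsto_subseq hp
  have hpφ' := tendsto_nhdsWithin_iff.2 ⟨hpφ, Filter.Eventually.of_forall fun j => hp (φ j)⟩
  have hδ : ∀ (r : ℕ → ℝ) (r₀ : ℝ), Filter.Tendsto r Filter.atTop (nhds r₀) → Filter.Tendsto
      (fun j => (1 - ε j) * r j + Real.log (1 - ε j) + ε j * Real.log (ε j)) Filter.atTop
      (nhds r₀) := by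
    intro r r₀ hr
    have hA : Filter.Tendsto (fun j => 1 - ε j) Filter.atTop (nhds 1) := by
      simpa using hεlim.const_sub 1
    have hB : Filter.Tendsto (fun j => Real.log (1 - ε j)) Filter.atTop (nhds 0) := by
      simpa using hA.log one_ne_zero
    have hC : Filter.Tendsto (fun j => ε j * Real.log (ε j)) Filter.atTop (nhds 0) := by
      simpa [Function.comp_def] using (Real.continuous_mul_log.tendsto 0).comp hεlim
    simpa using ((hA.mul hr).add hB).add hC
  refine ⟨ge_of_tendsto' hlim1 h1, ge_of_tendsto' hlim2 h2, p₀, hp₀, ?_, ?_⟩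
  · exact le_of_tendsto_of_tendsto' ((hδ _ _ (hlim2.mul_const _)).comp hφ.tendsto_atTop)
      ((continuousOn_condInfo hv Prod.snd p₀ hp₀).tendsto.comp hpφ') fun j => hb1 _
  · exact le_of_tendsto_of_tendsto' ((hδ _ _ ((hlim1.add hlim2).mul_const _)).comp
      hφ.tendsto_atTop) ((continuousOn_condInfo hv (fun _ => ()) p₀ hp₀).tendsto.comp hpφ') fun j => hb2 _

variable [MeasurableSingletonClass X₁] [MeasurableSingletonClass X₂]

theorem informedCapacityRegion_subset_singleLetterRegion [IsMarkovKernel W]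
    (hw : IsDensityFamily m w)
    (hW : ∀ z, W z = m.withDensity fun y => ENNReal.ofReal (w z y)) :
    informedCapacityRegion Q W ⊆ singleLetterRegion Q W := by
  classical
  intro R hR
  obtain ⟨h1, h2, p, hp, hb1, hb2⟩ := exists_bounds_of_mem_informedCapacityRegion hw hW hR
  obtain ⟨P, hP, rfl⟩ := exists_measure_real_singleton hp
  have hlog2 := Real.log_pos one_lt_two
  refine ⟨h1, h2, P, hP, ?_, ?_⟩
  · rw [condMutualInfo_compProd hw hW P]
    exact ENNReal.ofReal_le_ofReal ((le_div_iff₀ hlog2).2 hb1)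
  · rw [mutualInfo_compProd hw hW P]
    exact ENNReal.ofReal_le_ofReal ((le_div_iff₀ hlog2).2 hb2)

end Converse

/-! ### Achievability: one-shot random superposition coding -/

/-- A decoder that finds the message whose acceptance set contains the output. -/
theorem exists_measurable_decoder {K Z : Type*} [Fintype K] [Nonempty K] [MeasurableSpace K]
    [MeasurableSpace Z] {T : K → Set Z} (hT : ∀ k, MeasurableSet (T k)) :
    ∃ dec : Z → K, Measurable dec ∧ ∀ k z, z ∈ T k → (∀ k', k' ≠ k → z ∉ T k') → dec z = k := by
  classical
  let D : (K → Prop) → K := fun u => if h : ∃ k, u k then h.choose else Classical.arbitrary K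
  refine ⟨fun z => D fun k => z ∈ T k, ?_, ?_⟩
  · have hD : Measurable D := measurable_of_countable D
    exact hD.comp (measurable_pi_lambda _ fun k => measurableSet_setOfPred.1 (hT k))
  · intro k z hz hz'
    have hex : ∃ k, z ∈ T k := ⟨k, hz⟩
    simp only [D, dif_pos hex]
    by_contra hne
    exact hz' _ hne hex.choose_spec

/-- Counts the wrong messages: `M₁ - 1` share the cloud centre of the true one, `(Mc - 1) * M₁` do
not. -/
theorem sum_errors {Mc M₁ : ℕ} (k : Fin Mc × Fin M₁) (e₂ e₃ : ℝ≥0∞) :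
    ∑ k' ∈ Finset.univ.erase k, (if k'.1 = k.1 then e₂ else e₃) =
      (M₁ - 1 : ℕ) * e₂ + (Mc - 1 : ℕ) * M₁ * e₃ := by
  classical
  have h1 : ∑ k' ∈ Finset.univ.erase k, (if k'.1 = k.1 then e₂ else e₃) =
      ∑ k' : Fin Mc × Fin M₁, if k'.1 = k.1 then (if k'.2 = k.2 then 0 else e₂) else e₃ := by
    rw [← Finset.sum_erase_add _ _ (Finset.mem_univ k)]
    simp only [if_true, add_zero]
    refine Finset.sum_congr rfl fun k' hk' => ?_
    by_cases h : k'.1 = k.1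
    · have : k'.2 ≠ k.2 := fun h' => (Finset.mem_erase.1 hk').1 (Prod.ext h h')
      simp [h, this]
    · simp [h]
  rw [h1, Fintype.sum_prod_type, ← Finset.add_sum_erase _ _ (Finset.mem_univ k.1)]
  congr 1
  · simp only [if_true]
    rw [← Finset.add_sum_erase _ _ (Finset.mem_univ k.2), if_pos rfl, zero_add]
    rw [Finset.sum_congr rfl fun x hx => if_neg (Finset.ne_of_mem_erase hx)]
    simp [Finset.card_erase_of_mem]
  · rw [Finset.sum_congr rfl fun x hx => Finset.sum_congr rfl fun y _ =>
      if_neg (Finset.ne_of_mem_erase hx)]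
    simp [Finset.card_erase_of_mem, mul_assoc]

/-- One-shot superposition coding with threshold decoding. -/
theorem exists_superposition_code {A B Z : Type*} [Finite A] [MeasurableSpace A]
    [MeasurableSingletonClass A] [Finite B] [MeasurableSpace B] [MeasurableSingletonClass B]
    [MeasurableSpace Z] (pA : Measure A) [IsProbabilityMeasure pA] (κ : A → Measure B)
    [∀ a, IsProbabilityMeasure (κ a)] (V : B → A → Measure Z) {T : B → A → Set Z}
    (hT : ∀ b a, MeasurableSet (T b a)) {e₁ e₂ e₃ : ℝ≥0∞}
    (h₁ : ∫⁻ a, ∫⁻ b, V b a (T b a)ᶜ ∂κ a ∂pA ≤ e₁)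
    (h₂ : ∀ a b', ∫⁻ b, V b a (T b' a) ∂κ a ≤ e₂)
    (h₃ : ∀ a' b', ∫⁻ a, ∫⁻ b, V b a (T b' a') ∂κ a ∂pA ≤ e₃)
    {Mc M₁ : ℕ} (hMc : 0 < Mc) (hM₁ : 0 < M₁) :
    ∃ (x₁ : Fin Mc → Fin M₁ → B) (x₂ : Fin Mc → A) (dec : Z → Fin Mc × Fin M₁), Measurable dec ∧
      ∑ k : Fin Mc × Fin M₁, V (x₁ k.1 k.2) (x₂ k.1) {z | dec z ≠ k} ≤
        Mc * M₁ * (e₁ + ((M₁ - 1 : ℕ) * e₂ + (Mc - 1 : ℕ) * M₁ * e₃)) := by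
  classical
  have hne : Nonempty (Fin Mc × Fin M₁) := ⟨(⟨0, hMc⟩, ⟨0, hM₁⟩)⟩
  let p₂ : Measure (Fin Mc → A) := Measure.pi fun _ => pA
  let p₁ : (Fin Mc → A) → Measure (Fin Mc × Fin M₁ → B) := fun x₂ =>
    Measure.pi fun k => κ (x₂ k.1)
  have hp₁ : ∀ x₂, IsProbabilityMeasure (p₁ x₂) := fun x₂ => by simp only [p₁]; infer_instance
  -- Union bound for a fixed codebook: the true codeword is rejected, or a wrong one is accepted.
  let G : (Fin Mc → A) → (Fin Mc × Fin M₁ → B) → ℝ≥0∞ := fun x₂ x₁ =>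
    ∑ k, (V (x₁ k) (x₂ k.1) (T (x₁ k) (x₂ k.1))ᶜ +
      ∑ k' ∈ Finset.univ.erase k, V (x₁ k) (x₂ k.1) (T (x₁ k') (x₂ k'.1)))
  have hmean : ∫⁻ x₂, ∫⁻ x₁, G x₂ x₁ ∂p₁ x₂ ∂p₂ ≤
      Mc * M₁ * (e₁ + ((M₁ - 1 : ℕ) * e₂ + (Mc - 1 : ℕ) * M₁ * e₃)) := by
    have hexp : ∫⁻ x₂, ∫⁻ x₁, G x₂ x₁ ∂p₁ x₂ ∂p₂ =
        ∑ k, (∫⁻ x₂, ∫⁻ x₁, V (x₁ k) (x₂ k.1) (T (x₁ k) (x₂ k.1))ᶜ ∂p₁ x₂ ∂p₂ +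
          ∑ k' ∈ Finset.univ.erase k,
            ∫⁻ x₂, ∫⁻ x₁, V (x₁ k) (x₂ k.1) (T (x₁ k') (x₂ k'.1)) ∂p₁ x₂ ∂p₂) := by
      simp only [G]
      simp_rw [lintegral_finsetSum _ fun _ _ => measurable_of_countable _,
        lintegral_add_left (measurable_of_countable _),
        lintegral_finsetSum _ fun _ _ => measurable_of_countable _]
    have hself : ∀ k, ∫⁻ x₂, ∫⁻ x₁, V (x₁ k) (x₂ k.1) (T (x₁ k) (x₂ k.1))ᶜ ∂p₁ x₂ ∂p₂ ≤ e₁ := by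
      intro k
      refine le_trans (le_of_eq ?_) h₁
      simp only [p₁, p₂]
      rw [← lintegral_pi_eval (fun _ : Fin Mc => pA) k.1
        (f := fun a => ∫⁻ b, V b a (T b a)ᶜ ∂κ a) (measurable_of_countable _)]
      exact lintegral_congr fun x₂ => lintegral_pi_eval (fun k : Fin Mc × Fin M₁ => κ (x₂ k.1)) k
        (f := fun b => V b (x₂ k.1) (T b (x₂ k.1))ᶜ) (measurable_of_countable _)
    -- A competitor in the same cloud is independent of the true codeword given the centre, whence
    -- `e₂`. In another cloud the centres are independent as well, whence `e₃`.
    have hother : ∀ k, ∀ k' ∈ Finset.univ.erase k,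
        ∫⁻ x₂, ∫⁻ x₁, V (x₁ k) (x₂ k.1) (T (x₁ k') (x₂ k'.1)) ∂p₁ x₂ ∂p₂ ≤
          if k'.1 = k.1 then e₂ else e₃ := by
      intro k k' hk'
      have hkk := Finset.ne_of_mem_erase hk'
      have hinner : ∀ x₂ : Fin Mc → A, ∫⁻ x₁, V (x₁ k) (x₂ k.1) (T (x₁ k') (x₂ k'.1)) ∂p₁ x₂ =
          ∫⁻ b', ∫⁻ b, V b (x₂ k.1) (T b' (x₂ k'.1)) ∂κ (x₂ k.1) ∂κ (x₂ k'.1) := fun x₂ =>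
        lintegral_pi_eval_eval (fun k : Fin Mc × Fin M₁ => κ (x₂ k.1)) hkk
          (f := fun b' b => V b (x₂ k.1) (T b' (x₂ k'.1))) (measurable_of_countable _)
      simp_rw [hinner]
      split_ifs with h
      · rw [h]
        calc _ ≤ ∫⁻ x₂, ∫⁻ b', e₂ ∂κ (x₂ k.1) ∂p₂ :=
              lintegral_mono fun x₂ => lintegral_mono fun b' => h₂ _ _
          _ = e₂ := by simp [p₂]
      · rw [show ∫⁻ x₂, ∫⁻ b', ∫⁻ b, V b (x₂ k.1) (T b' (x₂ k'.1)) ∂κ (x₂ k.1) ∂κ (x₂ k'.1) ∂p₂ =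
          ∫⁻ a', ∫⁻ a, ∫⁻ b', ∫⁻ b, V b a (T b' a') ∂κ a ∂κ a' ∂pA ∂pA from
          lintegral_pi_eval_eval (fun _ : Fin Mc => pA) h
            (f := fun a' a => ∫⁻ b', ∫⁻ b, V b a (T b' a') ∂κ a ∂κ a') (measurable_of_countable _)]
        calc _ ≤ ∫⁻ _, e₃ ∂pA := by
              refine lintegral_mono fun a' => ?_
              -- The competitor's codeword has to be fixed outside the average over the true pair
              -- for `h₃` to apply.
              rw [lintegral_lintegral_swap (measurable_of_countable _).aemeasurable]
              calc _ ≤ ∫⁻ _, e₃ ∂κ a' := lintegral_mono fun b' => h₃ _ _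
                _ = e₃ := by simp
          _ = e₃ := by simp
    rw [hexp]
    calc _ ≤ ∑ k : Fin Mc × Fin M₁, (e₁ + ∑ k' ∈ Finset.univ.erase k,
          if k'.1 = k.1 then e₂ else e₃) :=
          Finset.sum_le_sum fun k _ => add_le_add (hself k) (Finset.sum_le_sum (hother k))
      _ = _ := by
          simp_rw [sum_errors]
          simp only [Finset.sum_const, Finset.card_univ, Fintype.card_prod, Fintype.card_fin,
            nsmul_eq_mul, Nat.cast_mul]
  -- Derandomization in two stages, as the law of the satellites depends on the centres.
  obtain ⟨x₂, hx₂⟩ := exists_le_lintegral (μ := p₂)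
    (f := fun x₂ => ∫⁻ x₁, G x₂ x₁ ∂p₁ x₂) (measurable_of_countable _).aemeasurable
  obtain ⟨x₁, hx₁⟩ := exists_le_lintegral (μ := p₁ x₂) (f := G x₂)
    (measurable_of_countable _).aemeasurable
  obtain ⟨dec, hdec, hcorrect⟩ := exists_measurable_decoder
    (T := fun k : Fin Mc × Fin M₁ => T (x₁ k) (x₂ k.1)) fun k => hT _ _
  refine ⟨fun wc w₁ => x₁ (wc, w₁), x₂, dec, hdec, le_trans (Finset.sum_le_sum fun k _ => ?_)
    (hx₁.trans (hx₂.trans hmean))⟩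
  have hsub : {z | dec z ≠ k} ⊆ (T (x₁ k) (x₂ k.1))ᶜ ∪
      ⋃ k' ∈ Finset.univ.erase k, T (x₁ k') (x₂ k'.1) := by
    intro z hz
    by_contra hcon
    simp only [Set.mem_union, Set.mem_compl_iff, not_or, not_not, Set.mem_iUnion, not_exists] at hcon
    exact hz (hcorrect k z hcon.1 fun k' hk' =>
      hcon.2 k' (Finset.mem_erase.2 ⟨hk', Finset.mem_univ _⟩))
  refine (measure_mono hsub).trans ((measure_union_le _ _).trans ?_)
  exact add_le_add le_rfl (measure_biUnion_finset_le _ _)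

/-! ### Threshold tests on likelihood ratios -/

theorem pi_sum_le_le_variance_div {Z : Type*} [MeasurableSpace Z] {μ : Measure Z}
    [IsProbabilityMeasure μ] {L : Z → ℝ} (hL : MemLp L 2 μ) {δ : ℝ} (hδ : 0 < δ) {n : ℕ}
    (hn : 0 < n) :
    Measure.pi (fun _ : Fin n => μ) {z | ∑ i, L (z i) ≤ n * (∫ z, L z ∂μ - δ)} ≤
      ENNReal.ofReal (Var[L; μ] / (n * δ ^ 2)) := by
  have hn' : (0 : ℝ) < n := by exact_mod_cast hn
  let X : (Fin n → Z) → ℝ := ∑ i, fun z => L (z i)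
  have hXi : ∀ i, MemLp (fun z : Fin n → Z => L (z i)) 2 (Measure.pi fun _ : Fin n => μ) := fun i =>
    hL.comp_measurePreserving (measurePreserving_eval (fun _ : Fin n => μ) i)
  have hX : MemLp X 2 (Measure.pi fun _ : Fin n => μ) := memLp_finsetSum' _ fun i _ => hXi i
  have hmean : ∫ z, X z ∂(Measure.pi fun _ : Fin n => μ) = n * ∫ z, L z ∂μ := by
    simp only [X, Finset.sum_apply]
    rw [integral_finsetSum _ fun i _ => (hXi i).integrable one_le_two]
    simp_rw [fun i : Fin n => integral_comp_eval (μ := fun _ : Fin n => μ) (i := i) (f := L)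
      hL.aestronglyMeasurable]
    simp
  have hvar : Var[X; Measure.pi fun _ : Fin n => μ] = n * Var[L; μ] := by
    rw [variance_sum_pi (X := fun _ : Fin n => L) fun _ => hL]
    simp
  have hcheb := meas_ge_le_variance_div_sq hX (c := n * δ) (by positivity)
  rw [hmean, hvar] at hcheb
  refine (measure_mono ?_).trans (hcheb.trans_eq ?_)
  · intro z hz
    have hz' : X z ≤ n * (∫ z, L z ∂μ - δ) := by simpa [X] using hz
    rw [Set.mem_ofPred_eq, abs_sub_comm]
    exact le_trans (by linarith) (le_abs_self _)
  · congr 1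
    field_simp

section Threshold

variable {X Γ Y : Type*} [Fintype X] [MeasurableSpace X] [MeasurableSingletonClass X]
  [DecidableEq Γ] [MeasurableSpace Y] {m : Measure Y} [IsFiniteMeasure m] {v : X → Y → ℝ}

omit [Fintype X] [MeasurableSpace X] [MeasurableSingletonClass X] in
-- Markov's inequality: under the law of density `∏ r`, the likelihood ratio `∏ (u / r)` has mean at
-- most `1`.
theorem pi_exp_le_prod_ratio_le {ι : Type*} [Fintype ι] {r u : ι → Y → ℝ}
    (hr : IsDensityFamily m r) (hu : IsDensityFamily m u) (t : ℝ) :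
    Measure.pi (fun i => m.withDensity fun y => ENNReal.ofReal (r i y))
      {y | Real.exp t ≤ ∏ i, (u i (y i) / r i (y i))} ≤ ENNReal.ofReal (Real.exp (-t)) := by
  have := hr.isProbabilityMeasure
  have hm : ∀ i, Measurable fun y => ENNReal.ofReal (u i y / r i y) := fun i =>
    ((hu.measurable i).div (hr.measurable i)).ennreal_ofReal
  have hone : ∀ i, ∫⁻ y, ENNReal.ofReal (u i y / r i y)
      ∂(m.withDensity fun y => ENNReal.ofReal (r i y)) ≤ 1 := by
    intro i
    rw [lintegral_withDensity_eq_lintegral_mul _ (hr.measurable i).ennreal_ofReal (hm i),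
      ← hu.lintegral_eq_one i]
    refine lintegral_mono fun y => ?_
    rw [Pi.mul_apply, ← ENNReal.ofReal_mul (hr.nonneg i y)]
    refine ENNReal.ofReal_le_ofReal ?_
    rcases (hr.nonneg i y).eq_or_lt with h0 | h0
    · rw [← h0, zero_mul]; exact hu.nonneg i y
    · rw [mul_div_cancel₀ _ h0.ne']
  have hmk := mul_meas_ge_le_lintegral
    (μ := Measure.pi (fun i => m.withDensity fun y => ENNReal.ofReal (r i y)))
    (f := fun y => ∏ i, ENNReal.ofReal (u i (y i) / r i (y i)))
    (Finset.measurable_prod _ fun i _ => (hm i).comp (measurable_pi_apply i))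
    (ENNReal.ofReal (Real.exp t))
  rw [lintegral_pi_prod _ hm] at hmk
  have hset : {y : ι → Y | ENNReal.ofReal (Real.exp t) ≤ ∏ i, ENNReal.ofReal (u i (y i) / r i (y i))} =
      {y | Real.exp t ≤ ∏ i, (u i (y i) / r i (y i))} := by
    ext y
    have h0 : ∀ i ∈ Finset.univ, 0 ≤ u i (y i) / r i (y i) := fun i _ =>
      div_nonneg (hu.nonneg _ _) (hr.nonneg _ _)
    rw [Set.mem_ofPred_eq, Set.mem_ofPred_eq, ← ENNReal.ofReal_prod_of_nonneg h0,
      ENNReal.ofReal_le_ofReal_iff (Finset.prod_nonneg h0)]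
  rw [hset] at hmk
  have h1 := hmk.trans (Finset.prod_le_one' fun i _ => hone i)
  rw [Real.exp_neg, ENNReal.ofReal_inv_of_pos (Real.exp_pos t), ← one_div,
    ENNReal.le_div_iff_mul_le (Or.inl (by simp [Real.exp_pos])) (Or.inl ENNReal.ofReal_ne_top),
    mul_comm]
  exact h1

omit [IsFiniteMeasure m] in
theorem ae_jointLaw_pos (h : IsDensityFamily m v) (p : X → ℝ) :
    ∀ᵐ z ∂jointLaw m v p, 0 < v z.1 z.2 ∧ 0 < p z.1 := by
  have hvm : Measurable fun z : X × Y => v z.1 z.2 := measurable_from_prod_countable_right h.measurable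
  have hpm : Measurable fun z : X × Y => p z.1 := (measurable_of_countable p).comp measurable_fst
  have hset : MeasurableSet {z : X × Y | 0 < v z.1 z.2 ∧ 0 < p z.1} :=
    (measurableSet_lt measurable_const hvm).inter (measurableSet_lt measurable_const hpm)
  rw [ae_iff, show {z : X × Y | ¬(0 < v z.1 z.2 ∧ 0 < p z.1)} =
    {z : X × Y | 0 < v z.1 z.2 ∧ 0 < p z.1}ᶜ from rfl, jointLaw_apply m v p hset.compl]
  refine Finset.sum_eq_zero fun a _ => ?_
  rcases le_or_gt (p a) 0 with hpa | hpa
  · rw [ENNReal.ofReal_of_nonpos hpa, zero_mul]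
  · have : ∀ᵐ y ∂(m.withDensity fun y => ENNReal.ofReal (v a y)), 0 < v a y := by
      rw [ae_withDensity_iff (h.measurable a).ennreal_ofReal]
      exact Filter.Eventually.of_forall fun y hy => by
        by_contra hcon
        exact hy (ENNReal.ofReal_of_nonpos (not_lt.1 hcon))
    rw [ae_iff] at this
    rw [show Prod.mk a ⁻¹' {z : X × Y | 0 < v z.1 z.2 ∧ 0 < p z.1}ᶜ = {y | ¬0 < v a y} by
      ext y; simp [hpa], this, mul_zero]

/-- The logarithm of the ratio of the output densities given the input and given the value of `c`. -/
noncomputable def logRatio (v : X → Y → ℝ) (c : X → Γ) (p : X → ℝ) (z : X × Y) : ℝ :=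
  Real.log (v z.1 z.2 / outputDensity v c p (c z.1) z.2)

/-- The true codeword's statistic has mean `condInfo` and a finite second moment, as Chebyshev's
inequality requires; letters of zero mass are invisible to the joint law. -/
theorem memLp_logRatio (h : IsDensityFamily m v) {p : X → ℝ} (hp : p ∈ stdSimplex ℝ X) (c : X → Γ) :
    MemLp (logRatio v c p) 2 (jointLaw m v p) ∧
      ∫ z, logRatio v c p z ∂jointLaw m v p = condInfo m v c p := by
  have hpart : ∀ a, Measurable fun y => logRatio v c p (a, y) := fun a =>
    ((h.measurable a).div (measurable_outputDensity (c := c) (p := p) h (c a))).log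
  have hmeas : Measurable (logRatio v c p) := measurable_from_prod_countable_right hpart
  constructor
  · rw [memLp_two_iff_integrable_sq hmeas.aestronglyMeasurable]
    refine integrable_jointLaw h (hmeas.pow_const 2) fun a hpa => ?_
    refine integrable_of_abs_le ((h.measurable a).mul ((hpart a).pow_const 2))
      (C := 2 * Real.log (p a) ^ 2 + 8) fun y => ?_
    rw [abs_of_nonneg (mul_nonneg (h.nonneg a y) (sq_nonneg _))]
    exact mul_log_div_sq_le hpa (h.nonneg a y) (h.le_one a y) (outputDensity_le_one h hp _ y)
      (le_outputDensity h hp hpa y)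
  · rw [integral_jointLaw h hp.1 hmeas fun a hpa => ?_]
    · rfl
    refine integrable_of_abs_le ((h.measurable a).mul (hpart a))
      (C := |Real.log (p a)| + 1) fun y => ?_
    exact abs_mul_log_div_le hpa (h.nonneg a y) (h.le_one a y) (outputDensity_le_one h hp _ y)
      (le_outputDensity h hp hpa y)

/-- The true codeword fails the threshold test with small probability. -/
theorem pi_jointLaw_not_exp_le (h : IsDensityFamily m v) {p : X → ℝ} (hp : p ∈ stdSimplex ℝ X)
    (c : X → Γ) {r : Γ → Y → ℝ}
    (hr : ∀ x, 0 < p x → ∀ y, r (c x) y = outputDensity v c p (c x) y) {δ : ℝ} (hδ : 0 < δ)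
    {n : ℕ} (hn : 0 < n) :
    Measure.pi (fun _ : Fin n => jointLaw m v p)
      {z | ¬ Real.exp (n * (condInfo m v c p - δ)) ≤
        ∏ i, (v (z i).1 (z i).2 / r (c (z i).1) (z i).2)} ≤
      ENNReal.ofReal (Var[logRatio v c p; jointLaw m v p] / (n * δ ^ 2)) := by
  have hprob := isProbabilityMeasure_jointLaw h hp
  obtain ⟨hmem, hmean⟩ := memLp_logRatio h hp c
  have hlln := pi_sum_le_le_variance_div hmem hδ hn
  rw [hmean] at hlln
  refine le_trans (measure_mono_ae ?_) hlln
  have hae : ∀ᵐ z ∂(Measure.pi fun _ : Fin n => jointLaw m v p),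
      ∀ i, 0 < v (z i).1 (z i).2 ∧ 0 < p (z i).1 := by
    rw [Filter.eventually_all]
    exact fun i => (Measure.tendsto_eval_ae_ae (μ := fun _ : Fin n => jointLaw m v p) (i := i)).eventually
      (ae_jointLaw_pos h p)
  filter_upwards [hae] with z hz hlt
  change ∑ i, logRatio v c p (z i) ≤ _
  have hlt' : ¬ Real.exp (n * (condInfo m v c p - δ)) ≤
        ∏ i, (v (z i).1 (z i).2 / r (c (z i).1) (z i).2) := hlt
  have hexp : Real.exp (∑ i, logRatio v c p (z i)) =
      ∏ i, (v (z i).1 (z i).2 / r (c (z i).1) (z i).2) := by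
    rw [Real.exp_sum]
    refine Finset.prod_congr rfl fun i _ => ?_
    have hpos := (mul_pos (hz i).2 (hz i).1).trans_le (le_outputDensity (c := c) h hp (hz i).2 (z i).2)
    rw [hr _ (hz i).2, logRatio, Real.exp_log (div_pos (hz i).1 hpos)]
  rw [← hexp, Real.exp_le_exp, not_le] at hlt'
  exact hlt'.le

end Threshold

/-- Drawing a cloud centre and then a satellite letter by letter is the same as drawing i.i.d. pairs
from `P`. -/
theorem lintegral_pi_lintegral_pi {ι X₁ X₂ : Type*} [Fintype ι]
    [Fintype X₁] [MeasurableSpace X₁] [MeasurableSingletonClass X₁]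
    [Fintype X₂] [MeasurableSpace X₂] [MeasurableSingletonClass X₂]
    {P : Measure (X₁ × X₂)} [IsProbabilityMeasure P] {P₂ : Measure X₂} [IsProbabilityMeasure P₂]
    {κ : X₂ → Measure X₁} [∀ b, IsProbabilityMeasure (κ b)]
    (hP : ∀ x, P {x} = P₂ {x.2} * κ x.2 {x.1}) (F : (ι → X₁) → (ι → X₂) → ℝ≥0∞) :
    ∫⁻ a, ∫⁻ b, F b a ∂(Measure.pi fun i => κ (a i)) ∂(Measure.pi fun _ : ι => P₂) =
      ∫⁻ x, F (fun i => (x i).1) (fun i => (x i).2) ∂(Measure.pi fun _ : ι => P) := by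
  classical
  simp only [lintegral_fintype, Measure.pi_singleton]
  rw [← (Equiv.arrowProdEquivProdArrow ι (fun _ => X₁) fun _ => X₂).symm.sum_comp,
    Fintype.sum_prod_type_right]
  refine Finset.sum_congr rfl fun a _ => ?_
  rw [Finset.sum_mul]
  refine Finset.sum_congr rfl fun b _ => ?_
  simp only [Equiv.arrowProdEquivProdArrow, Equiv.coe_fn_symm_mk, hP, Finset.prod_mul_distrib]
  ring

/-- Disintegration along the second input. Where the marginal vanishes a point mass is chosen, so
that `k b` is a probability law for every `b` and codewords can be drawn from it without exception.
-/
theorem exists_stochastic_factor {X₁ X₂ : Type*} [Fintype X₁] [Fintype X₂] [DecidableEq X₂]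
    {p : X₁ × X₂ → ℝ} (hp : p ∈ stdSimplex ℝ (X₁ × X₂)) :
    ∃ k : X₂ → X₁ → ℝ, (∀ b, k b ∈ stdSimplex ℝ X₁) ∧
      (∀ x, p x = marginal Prod.snd p x.2 * k x.2 x.1) ∧
      ∀ a b, 0 < marginal Prod.snd p b → k b a = p (a, b) / marginal Prod.snd p b := by
  classical
  have hne : Nonempty X₁ := by
    by_contra hcon
    rw [not_nonempty_iff] at hcon
    have := hp.2
    simp at this
  refine ⟨fun b => if 0 < marginal Prod.snd p b then fun a => p (a, b) / marginal Prod.snd p b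
    else Pi.single (Classical.arbitrary X₁) 1, fun b => ?_, fun x => ?_, fun a b hb => ?_⟩
  · beta_reduce
    split_ifs with hb
    · refine ⟨fun a => div_nonneg (hp.1 _) hb.le, ?_⟩
      rw [← Finset.sum_div, ← sum_fiber_snd]
      exact div_self hb.ne'
    · exact single_mem_stdSimplex ℝ _
  · rcases (marginal_nonneg (c := Prod.snd) hp x.2).eq_or_lt with h0 | h0
    · have h1 := le_marginal (c := Prod.snd) hp x
      rw [← h0] at h1 ⊢
      rw [zero_mul, le_antisymm h1 (hp.1 x)]
    · simp only [if_pos h0]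
      rw [mul_div_cancel₀ _ h0.ne']
  · simp only [if_pos hb]

/-! ### Achievability for the channel -/

section Achievability

variable {S X₁ X₂ Y : Type*}
    [Fintype S] [MeasurableSpace S] [MeasurableSingletonClass S]
    [Fintype X₁] [MeasurableSpace X₁] [MeasurableSingletonClass X₁]
    [Fintype X₂] [MeasurableSpace X₂] [MeasurableSingletonClass X₂]
    [MeasurableSpace Y]
    {Q : Measure S} [IsProbabilityMeasure Q]
    {W : Kernel ((X₁ × X₂) × S) Y} [IsMarkovKernel W]
    {m : Measure Y} [IsFiniteMeasure m] {w : (X₁ × X₂) × S → Y → ℝ}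

omit [Fintype X₁] [MeasurableSingletonClass X₁] [Fintype X₂]
  [MeasurableSingletonClass X₂] [IsFiniteMeasure m] in
-- The inputs do not depend on the states, so the i.i.d. states average out letter by letter and the
-- channel acts as the memoryless channel with density `avgDensity`.
theorem UninformedCode.error_eq {Mc M₁ n : ℕ} (hw : IsDensityFamily m w)
    (hW : ∀ z, W z = m.withDensity fun y => ENNReal.ofReal (w z y))
    (C : UninformedCode X₁ X₂ Y Mc M₁ n) :
    C.error Q W = (∑ k : Fin Mc × Fin M₁, Measure.pi (fun i => m.withDensity fun y =>
      ENNReal.ofReal (avgDensity (fun s => Q.real {s}) w (C.enc₁ i k.1 k.2, C.enc₂ i k.1) y))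
        {y | C.dec y ≠ k}) / ((Mc : ℝ≥0∞) * M₁) := by
  rw [UninformedCode.error, errorProb, Fintype.sum_prod_type]
  congr 1
  refine Finset.sum_congr rfl fun wc _ => Finset.sum_congr rfl fun w₁ _ => ?_
  rw [pi_mixture (fun _ : Fin n => Q) (fun i s => W ((C.enc₁ i wc w₁, C.enc₂ i wc), s))]
  simp_rw [sum_smul_channel hw hW]

theorem pi_withDensity_prodMk {X : Type*} [MeasurableSpace X] {n : ℕ} {v : X → Y → ℝ}
    (hv : IsDensityFamily m v) (x : Fin n → X) {E : Set (Fin n → X × Y)} (hE : MeasurableSet E) :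
    Measure.pi (fun i => m.withDensity fun y => ENNReal.ofReal (v (x i) y))
      {y | (fun i => (x i, y i)) ∈ E} =
    Measure.pi (fun i => (m.withDensity fun y => ENNReal.ofReal (v (x i) y)).map (Prod.mk (x i))) E := by
  have := hv.isProbabilityMeasure
  have hp : ∀ i, IsProbabilityMeasure
      ((m.withDensity fun y => ENNReal.ofReal (v (x i) y)).map (Prod.mk (x i))) :=
    fun i => Measure.isProbabilityMeasure_map measurable_prodMk_left.aemeasurable
  rw [← Measure.pi_map_pi fun i => measurable_prodMk_left.aemeasurable, Measure.map_apply _ hE]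
  · rfl
  · exact measurable_pi_lambda _ fun i => measurable_prodMk_left.comp (measurable_pi_apply i)

/-- `B` is the sum of the variances of the two log ratios, so it depends on neither `n`, `δ` nor the
numbers of messages. The factors `M₁ - 1` and `Mc - 1` are kept exact: they vanish for a single
message, which covers zero rates without a gap. -/
theorem exists_uninformedCode [DecidableEq X₂] (hw : IsDensityFamily m w)
    (hW : ∀ z, W z = m.withDensity fun y => ENNReal.ofReal (w z y))
    (P : Measure (X₁ × X₂)) [IsProbabilityMeasure P] :
    ∃ B : ℝ, 0 ≤ B ∧ ∀ (δ : ℝ) (n Mc M₁ : ℕ), 0 < δ → 0 < n → 0 < Mc → 0 < M₁ →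
      ∃ C : UninformedCode X₁ X₂ Y Mc M₁ n, C.error Q W ≤ ENNReal.ofReal (B / (n * δ ^ 2) +
        (((M₁ : ℝ) - 1) * Real.exp (-(n * (condInfo m (avgDensity (fun s => Q.real {s}) w) Prod.snd
            (fun x => P.real {x}) - δ))) +
          ((Mc : ℝ) - 1) * M₁ * Real.exp (-(n * (condInfo m (avgDensity (fun s => Q.real {s}) w)
            (fun _ => ()) (fun x => P.real {x}) - δ))))) := by
  classical
  have hq := real_singleton_mem_stdSimplex Q
  have hp := real_singleton_mem_stdSimplex P
  have hv := avgDensity_isDensityFamily hw hq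
  have hvp := hv.isProbabilityMeasure
  set v := avgDensity (fun s => Q.real {s}) w with hvdef
  set p : X₁ × X₂ → ℝ := fun x => P.real {x} with hpdef
  obtain ⟨k, hk, hpk, hkdiv⟩ := exists_stochastic_factor hp
  have hmarg : marginal Prod.snd p ∈ stdSimplex ℝ X₂ := by
    refine ⟨marginal_nonneg hp, ?_⟩
    simp only [marginal]
    rw [Finset.sum_fiberwise, hp.2]
  obtain ⟨P₂, hP₂, hP₂m⟩ := exists_measure_real_singleton hmarg
  choose κ hκ hκk using fun b => exists_measure_real_singleton (hk b)
  have hP : ∀ x, P {x} = P₂ {x.2} * κ x.2 {x.1} := by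
    intro x
    rw [← ofReal_measureReal (μ := P), ← ofReal_measureReal (μ := P₂),
      ← ofReal_measureReal (μ := κ x.2), ← ENNReal.ofReal_mul measureReal_nonneg]
    congr 1
    rw [congrFun hP₂m x.2, congrFun (hκk x.2) x.1]
    exact hpk x
  -- Output densities built from the stochastic factors. They agree with `outputDensity` at charged
  -- letters but are probability densities at every letter, as the bound on wrong codewords
  -- requires.
  let r₁ : X₂ → Y → ℝ := fun b y => ∑ a, k b a * v (a, b) y
  let r₀ : Y → ℝ := fun y => ∑ b, marginal Prod.snd p b * r₁ b y
  have hr₁ : IsDensityFamily m r₁ :=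
    IsDensityFamily.mixture (w := fun b a => v (a, b)) (fun b => hv.comp fun a => (a, b))
      (fun b => (hk b).1) fun b => (hk b).2
  have hr₁p := hr₁.isProbabilityMeasure
  have hr₀ : IsDensityFamily m fun _ : Unit => r₀ :=
    IsDensityFamily.mixture (w := fun _ => r₁) (fun _ => hr₁) (fun _ => hmarg.1) fun _ => hmarg.2
  have hr₁' : ∀ x, 0 < p x → ∀ y, r₁ x.2 y = outputDensity v Prod.snd p x.2 y := by
    intro x hx y
    have h0 : 0 < marginal Prod.snd p x.2 := hx.trans_le (le_marginal hp x)
    rw [outputDensity, sum_fiber_snd (fun x => p x * v x y), Finset.sum_div]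
    refine Finset.sum_congr rfl fun a _ => ?_
    rw [hkdiv _ _ h0]
    ring
  have hr₀' : ∀ x, 0 < p x → ∀ y, r₀ y = outputDensity v (fun _ => ()) p () y := by
    intro _ _ y
    rw [outputDensity_unit hp, Fintype.sum_prod_type_right]
    refine Finset.sum_congr rfl fun b _ => ?_
    rw [Finset.mul_sum]
    refine Finset.sum_congr rfl fun a _ => ?_
    rw [hpk (a, b)]
    ring
  have hmix₁ : ∀ b, ∑ a, κ b {a} • m.withDensity (fun y => ENNReal.ofReal (v (a, b) y)) =
      m.withDensity fun y => ENNReal.ofReal (r₁ b y) := by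
    intro b
    rw [← withDensity_mixture (hv.comp fun a => (a, b)) (hk b).1]
    refine Finset.sum_congr rfl fun a _ => ?_
    rw [← congrFun (hκk b) a, ofReal_measureReal]
  have hmix₀ : ∑ b, P₂ {b} • m.withDensity (fun y => ENNReal.ofReal (r₁ b y)) =
      m.withDensity fun y => ENNReal.ofReal (r₀ y) := by
    rw [← withDensity_mixture hr₁ hmarg.1]
    refine Finset.sum_congr rfl fun b _ => ?_
    rw [← congrFun hP₂m b, ofReal_measureReal]
  let I₁ := condInfo m v Prod.snd p
  let I₀ := condInfo m v (fun _ => ()) p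
  let B₁ := Var[logRatio v Prod.snd p; jointLaw m v p]
  let B₀ := Var[logRatio v (fun _ => ()) p; jointLaw m v p]
  refine ⟨B₁ + B₀, add_nonneg (variance_nonneg _ _) (variance_nonneg _ _),
    fun δ n Mc M₁ hδ hn hMc hM₁ => ?_⟩
  have hδn : 0 < n * δ ^ 2 := by positivity
  -- Two tests: `E₁`, against the output law given Encoder 2's input, rejects competitors in the
  -- same cloud; `E₀`, against the unconditional output law, rejects those in other clouds.
  let E₁ : Set (Fin n → (X₁ × X₂) × Y) := {z | Real.exp (n * (I₁ - δ)) ≤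
    ∏ i, (v (z i).1 (z i).2 / r₁ (z i).1.2 (z i).2)}
  let E₀ : Set (Fin n → (X₁ × X₂) × Y) := {z | Real.exp (n * (I₀ - δ)) ≤
    ∏ i, (v (z i).1 (z i).2 / r₀ (z i).2)}
  have hE₁ : MeasurableSet E₁ := by
    refine measurableSet_le measurable_const (Finset.measurable_prod _ fun i _ => ?_)
    exact (show Measurable fun z : (X₁ × X₂) × Y => v z.1 z.2 / r₁ z.1.2 z.2 from
      measurable_from_prod_countable_right fun x => (hv.measurable x).div (hr₁.measurable x.2)).comp
        (measurable_pi_apply i)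
  have hE₀ : MeasurableSet E₀ := by
    refine measurableSet_le measurable_const (Finset.measurable_prod _ fun i _ => ?_)
    exact (show Measurable fun z : (X₁ × X₂) × Y => v z.1 z.2 / r₀ z.2 from
      measurable_from_prod_countable_right fun x => (hv.measurable x).div (hr₀.measurable ())).comp
        (measurable_pi_apply i)
  let V : (Fin n → X₁) → (Fin n → X₂) → Measure (Fin n → Y) := fun b a =>
    Measure.pi fun i => m.withDensity fun y => ENNReal.ofReal (v (b i, a i) y)
  let T : (Fin n → X₁) → (Fin n → X₂) → Set (Fin n → Y) := fun b a =>
    {y | (fun i => ((b i, a i), y i)) ∈ E₁ ∩ E₀}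
  have hins : ∀ (b : Fin n → X₁) (a : Fin n → X₂),
      Measurable fun (y : Fin n → Y) (i : Fin n) => ((b i, a i), y i) := fun b a =>
    measurable_pi_lambda _ fun i => measurable_prodMk_left.comp (measurable_pi_apply i)
  have hT : ∀ b a, MeasurableSet (T b a) := fun b a => hins b a (hE₁.inter hE₀)
  have h₁ : ∫⁻ a, ∫⁻ b, V b a (T b a)ᶜ ∂(Measure.pi fun i => κ (a i)) ∂(Measure.pi fun _ => P₂) ≤
      ENNReal.ofReal ((B₁ + B₀) / (n * δ ^ 2)) := by
    rw [lintegral_pi_lintegral_pi hP fun b a => V b a (T b a)ᶜ]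
    have hstep : ∀ x : Fin n → X₁ × X₂,
        V (fun i => (x i).1) (fun i => (x i).2) (T (fun i => (x i).1) fun i => (x i).2)ᶜ =
        Measure.pi (fun i => (m.withDensity fun y => ENNReal.ofReal (v (x i) y)).map
          (Prod.mk (x i))) (E₁ ∩ E₀)ᶜ := fun x =>
      pi_withDensity_prodMk hv x (hE₁.inter hE₀).compl
    simp_rw [hstep]
    have hprob : ∀ x, IsProbabilityMeasure
        ((m.withDensity fun y => ENNReal.ofReal (v x y)).map (Prod.mk x)) :=
      fun x => Measure.isProbabilityMeasure_map measurable_prodMk_left.aemeasurable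
    rw [pi_mixture (fun _ : Fin n => P)
      fun _ x => (m.withDensity fun y => ENNReal.ofReal (v x y)).map (Prod.mk x)]
    have hjoint : ∑ x, P {x} • (m.withDensity fun y => ENNReal.ofReal (v x y)).map (Prod.mk x) =
        jointLaw m v p := by
      refine Finset.sum_congr rfl fun x _ => ?_
      rw [ofReal_measureReal]
    simp_rw [hjoint]
    rw [Set.compl_inter, add_div, ENNReal.ofReal_add
      (div_nonneg (variance_nonneg _ _) hδn.le) (div_nonneg (variance_nonneg _ _) hδn.le)]
    exact (measure_union_le _ _).trans (add_le_add
      (pi_jointLaw_not_exp_le hv hp Prod.snd hr₁' hδ hn)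
      (pi_jointLaw_not_exp_le hv hp (fun _ => ()) (r := fun _ => r₀) hr₀' hδ hn))
  have hV₁ : ∀ (a : Fin n → X₂) (E : Set (Fin n → Y)),
      ∫⁻ b, V b a E ∂(Measure.pi fun i => κ (a i)) =
        Measure.pi (fun i => m.withDensity fun y => ENNReal.ofReal (r₁ (a i) y)) E := by
    intro a E
    simp only [V]
    rw [pi_mixture (fun i => κ (a i))
      fun i x => m.withDensity fun y => ENNReal.ofReal (v (x, a i) y)]
    simp_rw [hmix₁]
  have h₂ : ∀ a b', ∫⁻ b, V b a (T b' a) ∂(Measure.pi fun i => κ (a i)) ≤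
      ENNReal.ofReal (Real.exp (-(n * (I₁ - δ)))) := by
    intro a b'
    rw [hV₁]
    refine (measure_mono fun y hy => hy.1).trans (pi_exp_le_prod_ratio_le (m := m)
      (hr₁.comp a) (hv.comp fun i => (b' i, a i)) (n * (I₁ - δ)))
  have h₃ : ∀ a' b', ∫⁻ a, ∫⁻ b, V b a (T b' a') ∂(Measure.pi fun i => κ (a i))
      ∂(Measure.pi fun _ => P₂) ≤ ENNReal.ofReal (Real.exp (-(n * (I₀ - δ)))) := by
    intro a' b'
    simp_rw [hV₁]
    rw [pi_mixture (fun _ : Fin n => P₂)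
      fun _ b => m.withDensity fun y => ENNReal.ofReal (r₁ b y)]
    simp_rw [hmix₀]
    refine (measure_mono fun y hy => hy.2).trans (pi_exp_le_prod_ratio_le (m := m)
      (hr₀.comp fun _ => ()) (hv.comp fun i => (b' i, a' i)) (n * (I₀ - δ)))
  obtain ⟨x₁, x₂, dec, hdec, hsum⟩ := exists_superposition_code (Measure.pi fun _ : Fin n => P₂)
    (fun a => Measure.pi fun i => κ (a i)) V hT h₁ h₂ h₃ hMc hM₁
  refine ⟨⟨fun i wc w₁ => x₁ wc w₁ i, fun i wc => x₂ wc i, dec, hdec⟩, ?_⟩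
  rw [UninformedCode.error_eq hw hW]
  have hMM : ((Mc : ℝ≥0∞) * M₁) ≠ 0 := by simp [hMc.ne', hM₁.ne']
  refine (ENNReal.div_le_iff' hMM (ENNReal.mul_ne_top (by simp) (by simp))).2
    (hsum.trans_eq ?_)
  have hM₁' : (0 : ℝ) ≤ (M₁ : ℝ) - 1 := sub_nonneg.2 (by exact_mod_cast hM₁)
  have hMc' : (0 : ℝ) ≤ (Mc : ℝ) - 1 := sub_nonneg.2 (by exact_mod_cast hMc)
  have hcast : ∀ M : ℕ, 0 < M → ((M - 1 : ℕ) : ℝ≥0∞) = ENNReal.ofReal ((M : ℝ) - 1) := by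
    intro M hM
    rw [← ENNReal.ofReal_natCast, Nat.cast_sub hM, Nat.cast_one]
  have hB : 0 ≤ (B₁ + B₀) / (n * δ ^ 2) :=
    div_nonneg (add_nonneg (variance_nonneg _ _) (variance_nonneg _ _)) hδn.le
  rw [ENNReal.ofReal_add hB (by positivity), ENNReal.ofReal_add (by positivity) (by positivity),
    ENNReal.ofReal_mul hM₁', ENNReal.ofReal_mul (by positivity), ENNReal.ofReal_mul hMc',
    ENNReal.ofReal_natCast, hcast _ hM₁, hcast _ hMc]

/-- Rational rates make `2 ^ (n * R)` an integer for suitable arbitrarily large `n`. A zero rate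
means a single message and an empty error term, so its inequality may be dropped. -/
theorem uninformedAchievable_of_lt [DecidableEq X₂] (hw : IsDensityFamily m w)
    (hW : ∀ z, W z = m.withDensity fun y => ENNReal.ofReal (w z y))
    (P : Measure (X₁ × X₂)) [IsProbabilityMeasure P] {kc qc k₁ q₁ : ℕ} (hqc : 0 < qc) (hq₁ : 0 < q₁)
    (h₁ : k₁ = 0 ∨ (k₁ / q₁ : ℝ) * Real.log 2 <
      condInfo m (avgDensity (fun s => Q.real {s}) w) Prod.snd fun x => P.real {x})
    (h₀ : kc = 0 ∨ (kc / qc + k₁ / q₁ : ℝ) * Real.log 2 <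
      condInfo m (avgDensity (fun s => Q.real {s}) w) (fun _ => ()) fun x => P.real {x}) :
    UninformedAchievable Q W (kc / qc, k₁ / q₁) := by
  intro ε hε
  obtain ⟨B, hB, hcode⟩ := exists_uninformedCode (Q := Q) hw hW P
  set I₁ := condInfo m (avgDensity (fun s => Q.real {s}) w) Prod.snd fun x => P.real {x}
  set I₀ := condInfo m (avgDensity (fun s => Q.real {s}) w) (fun _ => ()) fun x => P.real {x}
  -- A gap of `2 * δ`: one `δ` is lost in the threshold, the other leaves the decay `exp (-(n *
  -- δ))`.
  have hgap : ∀ (k : ℕ) (a b : ℝ), (k = 0 ∨ a < b) →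
      ∃ δ : ℝ, 0 < δ ∧ (k = 0 ∨ a + 2 * δ ≤ b) := by
    rintro k a b (h | h)
    · exact ⟨1, one_pos, Or.inl h⟩
    · exact ⟨(b - a) / 2, by linarith, Or.inr (by linarith)⟩
  obtain ⟨δ₁, hδ₁, hgap₁⟩ := hgap _ _ _ h₁
  obtain ⟨δ₀, hδ₀, hgap₀⟩ := hgap _ _ _ h₀
  obtain ⟨δ, hδ, hle₁, hle₀⟩ : ∃ δ : ℝ, 0 < δ ∧ δ ≤ δ₁ ∧ δ ≤ δ₀ :=
    ⟨min δ₁ δ₀, lt_min hδ₁ hδ₀, min_le_left _ _, min_le_right _ _⟩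
  -- With `exp (-(n * δ)) ≤ 1 / (n * δ)` for each of the two wrong-message terms, the whole error is
  -- at most `A / n`.
  let A : ℝ := B / δ ^ 2 + 2 / δ
  obtain ⟨j, hj⟩ := exists_nat_ge (max 1 (A / ε))
  have hj1 : (1 : ℝ) ≤ j := (le_max_left _ _).trans hj
  have hjA : A / ε ≤ j := (le_max_right _ _).trans hj
  have hj0 : 0 < j := by exact_mod_cast hj1
  -- A multiple of both denominators, and at least `j ≥ A / ε`.
  let n := qc * q₁ * j
  have hn : 0 < n := by positivity
  have hnR : (0 : ℝ) < n := by exact_mod_cast hn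
  have hnj : (j : ℝ) ≤ n := by
    have : j ≤ n := Nat.le_mul_of_pos_left j (Nat.mul_pos hqc hq₁)
    exact_mod_cast this
  have hqcR : (0 : ℝ) < qc := by exact_mod_cast hqc
  have hq₁R : (0 : ℝ) < q₁ := by exact_mod_cast hq₁
  let Mc := 2 ^ (kc * q₁ * j)
  let M₁ := 2 ^ (k₁ * qc * j)
  have hMc : (Mc : ℝ) = (2 : ℝ) ^ ((n : ℝ) * (kc / qc : ℝ)) := by
    rw [show (n : ℝ) * (kc / qc : ℝ) = ((kc * q₁ * j : ℕ) : ℝ) by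
      simp only [n]; push_cast; field_simp, Real.rpow_natCast]
    simp [Mc]
  have hM₁ : (M₁ : ℝ) = (2 : ℝ) ^ ((n : ℝ) * (k₁ / q₁ : ℝ)) := by
    rw [show (n : ℝ) * (k₁ / q₁ : ℝ) = ((k₁ * qc * j : ℕ) : ℝ) by
      simp only [n]; push_cast; field_simp, Real.rpow_natCast]
    simp [M₁]
  have hexp : ∀ x : ℝ, (2 : ℝ) ^ ((n : ℝ) * x) = Real.exp (n * (x * Real.log 2)) := fun x => by
    rw [Real.rpow_def_of_pos two_pos]; ring_nf
  obtain ⟨C, hC⟩ := hcode δ n Mc M₁ hδ hn (by positivity) (by positivity)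
  refine ⟨n, Mc, M₁, hn, by positivity, by positivity, hMc, hM₁, C,
    hC.trans (ENNReal.ofReal_le_ofReal ?_)⟩
  have hsmall : Real.exp (-(n * δ)) ≤ 1 / (n * δ) := by
    rw [Real.exp_neg, ← one_div]
    exact one_div_le_one_div_of_le (by positivity) ((Real.add_one_le_exp _).trans' (by linarith))
  have hM₁1 : (1 : ℝ) ≤ M₁ := by exact_mod_cast Nat.one_le_two_pow
  have ht₁ : ((M₁ : ℝ) - 1) * Real.exp (-(n * (I₁ - δ))) ≤ Real.exp (-(n * δ)) := by
    rcases hgap₁ with h | h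
    · simp [M₁, h, Real.exp_nonneg]
    · calc ((M₁ : ℝ) - 1) * Real.exp (-(n * (I₁ - δ)))
          ≤ M₁ * Real.exp (-(n * (I₁ - δ))) :=
            mul_le_mul_of_nonneg_right (by linarith) (Real.exp_nonneg _)
        _ = Real.exp (n * ((k₁ / q₁ : ℝ) * Real.log 2) + -(n * (I₁ - δ))) := by
            rw [hM₁, hexp, Real.exp_add]
        _ ≤ _ := by
            refine Real.exp_le_exp.2 ?_
            have : (n : ℝ) * ((k₁ / q₁ : ℝ) * Real.log 2 + 2 * δ) ≤ n * I₁ :=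
              mul_le_mul_of_nonneg_left (by linarith) hnR.le
            linarith
  have ht₀ : ((Mc : ℝ) - 1) * M₁ * Real.exp (-(n * (I₀ - δ))) ≤ Real.exp (-(n * δ)) := by
    rcases hgap₀ with h | h
    · simp [Mc, h, Real.exp_nonneg]
    · calc ((Mc : ℝ) - 1) * M₁ * Real.exp (-(n * (I₀ - δ)))
          ≤ Mc * M₁ * Real.exp (-(n * (I₀ - δ))) := by
            refine mul_le_mul_of_nonneg_right ?_ (Real.exp_nonneg _)
            exact mul_le_mul_of_nonneg_right (by linarith) (by linarith)
        _ = Real.exp (n * ((kc / qc : ℝ) * Real.log 2) + n * ((k₁ / q₁ : ℝ) * Real.log 2) +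
              -(n * (I₀ - δ))) := by
            rw [hM₁, hMc, hexp, hexp, Real.exp_add, Real.exp_add]
        _ ≤ _ := by
            refine Real.exp_le_exp.2 ?_
            have : (n : ℝ) * ((kc / qc + k₁ / q₁ : ℝ) * Real.log 2 + 2 * δ) ≤ n * I₀ :=
              mul_le_mul_of_nonneg_left (by linarith) hnR.le
            linarith
  have hA : B / (n * δ ^ 2) + 2 * (1 / (n * δ)) = A / n := by
    simp only [A]; field_simp
  have hAε : A / n ≤ ε := by
    rw [div_le_iff₀ hε] at hjA
    rw [div_le_iff₀ hnR]
    nlinarith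
  linarith

/-- Approximation from strictly below, except at `0`, which is kept exactly since rates cannot be
negative. -/
theorem exists_nat_div_approx {x η : ℝ} (hx : 0 ≤ x) (hη : 0 < η) :
    ∃ k q : ℕ, 0 < q ∧ dist x (k / q : ℝ) < η ∧ (k / q : ℝ) ≤ x ∧ (k = 0 ∨ (k / q : ℝ) < x) := by
  rcases hx.eq_or_lt with rfl | hx
  · exact ⟨0, 1, one_pos, by simpa using hη, by simp, Or.inl rfl⟩
  · obtain ⟨r, hr1, hr2⟩ := exists_rat_btwn (show max 0 (x - η) < x from max_lt hx (by linarith))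
    have hr0 : (0 : ℝ) < r := (le_max_left _ _).trans_lt hr1
    have hrη : x - η < r := (le_max_right _ _).trans_lt hr1
    have hnum : 0 ≤ r.num := Rat.num_nonneg.2 (by exact_mod_cast hr0.le)
    have hcast : ((r.num.toNat : ℕ) : ℝ) / (r.den : ℝ) = r := by
      conv_rhs => rw [Rat.cast_def]
      congr 1
      exact_mod_cast congrArg (Int.cast (R := ℝ)) (Int.toNat_of_nonneg hnum)
    refine ⟨r.num.toNat, r.den, r.den_pos, ?_, ?_, Or.inr ?_⟩ <;> rw [hcast]
    · rw [Real.dist_eq, abs_lt]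
      constructor <;> linarith
    · exact hr2.le
    · exact hr2

theorem singleLetterRegion_subset_uninformedCapacityRegion (hw : IsDensityFamily m w)
    (hW : ∀ z, W z = m.withDensity fun y => ENNReal.ofReal (w z y)) :
    singleLetterRegion Q W ⊆ uninformedCapacityRegion Q W := by
  classical
  rintro ⟨Rc, R₁⟩ ⟨hRc, hR₁, P, hP, h₁, h₀⟩
  simp only at hRc hR₁ h₁ h₀
  rw [condMutualInfo_compProd hw hW P] at h₁
  rw [mutualInfo_compProd hw hW P] at h₀
  have hlog2 := Real.log_pos one_lt_two
  refine Metric.mem_closure_iff.2 fun η hη => ?_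
  obtain ⟨kc, qc, hqc, hdc, hlec, hltc⟩ := exists_nat_div_approx hRc hη
  obtain ⟨k₁, q₁, hq₁, hd₁, hle₁, hlt₁⟩ := exists_nat_div_approx hR₁ hη
  refine ⟨(kc / qc, k₁ / q₁), uninformedAchievable_of_lt hw hW P hqc hq₁ ?_ ?_, ?_⟩
  · refine hlt₁.imp_right fun hlt => ?_
    have hpos : 0 < R₁ := lt_of_le_of_lt (by positivity) hlt
    -- An inequality between `ENNReal.ofReal` values would also hold for a nonpositive rate;
    -- positivity excludes this case.
    have := (ENNReal.ofReal_le_ofReal_iff'.1 h₁).resolve_right (not_le.2 hpos)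
    exact (mul_lt_mul_of_pos_right hlt hlog2).trans_le ((le_div_iff₀ hlog2).1 this)
  · refine hltc.imp_right fun hlt => ?_
    have hpos : 0 < Rc + R₁ := add_pos_of_pos_of_nonneg (lt_of_le_of_lt (by positivity) hlt) hR₁
    have := (ENNReal.ofReal_le_ofReal_iff'.1 h₀).resolve_right (not_le.2 hpos)
    exact (mul_lt_mul_of_pos_right (add_lt_add_of_lt_of_le hlt hle₁) hlog2).trans_le
      ((le_div_iff₀ hlog2).1 this)
  · rw [Prod.dist_eq]
    exact max_lt hdc hd₁

end Achievability

theorem uninformedCapacityRegion_subset_informedCapacityRegion {S X₁ X₂ Y : Type*}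
    [MeasurableSpace S] [MeasurableSpace X₁] [MeasurableSpace X₂] [MeasurableSpace Y]
    (Q : Measure S) (W : Kernel ((X₁ × X₂) × S) Y) :
    uninformedCapacityRegion Q W ⊆ informedCapacityRegion Q W := by
  refine closure_mono fun R hR ε hε => ?_
  obtain ⟨n, Mc, M₁, hn, hMc, hM₁, hc, h₁, C, hC⟩ := hR ε hε
  exact ⟨n, Mc, M₁, hn, hMc, hM₁, hc, h₁,
    ⟨fun i wc w₁ _ => C.enc₁ i wc w₁, C.enc₂, C.dec, C.measurable_dec⟩, hC⟩

end CoopMAC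

theorem proposition4 {S X₁ X₂ Y : Type*}
    [Fintype S] [MeasurableSpace S] [MeasurableSingletonClass S]
    [Fintype X₁] [MeasurableSpace X₁] [MeasurableSingletonClass X₁]
    [Fintype X₂] [MeasurableSpace X₂] [MeasurableSingletonClass X₂]
    [MeasurableSpace Y]
    (Q : Measure S) [IsProbabilityMeasure Q]
    (W : Kernel ((X₁ × X₂) × S) Y) [IsMarkovKernel W] :
    CoopMAC.informedCapacityRegion Q W = CoopMAC.uninformedCapacityRegion Q W ∧
      CoopMAC.informedCapacityRegion Q W = CoopMAC.singleLetterRegion Q W := by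
  obtain ⟨m, w, hm, hw, hW⟩ := CoopMAC.exists_isDensityFamily fun z => W z
  have h₁ := CoopMAC.informedCapacityRegion_subset_singleLetterRegion (Q := Q) hw hW
  have h₂ := CoopMAC.singleLetterRegion_subset_uninformedCapacityRegion (Q := Q) hw hW
  have h₃ := CoopMAC.uninformedCapacityRegion_subset_informedCapacityRegion Q W
  exact ⟨(h₁.trans h₂).antisymm h₃, h₁.antisymm (h₂.trans h₃)⟩
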